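/- Setting. Let $\Delta u(a)=-4u(a)+\sum_{b}u(b)$, the sum running over the four nearest neighbours $b$ of $a\in\mathbb Z^2$. For $\bar V\ge 2$ let $V:\mathbb Z^2\to\{0,\bar V\}$ be a random potential whose values are i.i.d. with $\mathbb P[V(a)=0]=\mathbb P[V(a)=\bar V]=\frac12$, and let $H=-\Delta+V$. For $a\in\mathbb Z^2$ and real $l$ let $Q_l(a)=\{b\in\mathbb Z^2:\|a-b\|_\infty\le\frac{l-1}2\}$. A square (box) is a set $Q=Q_l(a)$ with $l\ge1$; its side length is $\ell(Q)=2\lfloor\frac{l-1}2\rfloor$, and $\frac{1}{100}Q=Q_{l/100}(a)$. For $u:\mathbb Z^2\to\mathbb R$, "$Hu=\lambda u$ in $Q$" means $(Hu)(b)=\lambda u(b)$ for every $b\in Q$. A tilted square is a set $\{(x,y)\in\mathbb Z^2: x+y\in I,\ x-y\in J\}$ with finite integer intervals $I,J$ having equally many elements. A set $\Theta\subset\mathbb Z^2$ is $\eta$-sparse in a tilted square $R$ if $|D\cap\Theta\cap R|\le\eta|D\cap R|$ for every diagonal $D=\{x+y=k\}$ and $D=\{x-y=k\}$, $k\in\mathbb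 Z$. It is $\eta$-regular in a finite set $E\subset\mathbb Z^2$ if $\sum_k|R_k|\le\eta|E|$ for all finitely many disjoint tilted squares $R_1,\dots,R_n\subset E$ in none of which $\Theta$ is $\eta$-sparse. Theorem 1.3, with its frozen-set version. (i) There is $\varepsilon_0>0$ such that for every $0<\varepsilon\le\varepsilon_0$ there is $\alpha>1$ with the following property. If $\lambda_0\in[0,8]$, $\bar V\ge2$ and $Q$ is a square of side length $L=\ell(Q)\ge\alpha$, then with probability at least $1-\exp(-\varepsilon L^{2/3})$ the following holds: for all $\lambda\in\mathbb R$ and $u:\mathbb Z^2\to\mathbb R$ with $|\lambda-\lambda_0|\le(\bar VL)^{-\alpha L}$ and $Hu=\lambda u$ in $Q$, $$\Big|\big\{b\in Q:\ |u(b)|\ge(\bar VL)^{-\alpha L}\,\|u\|_{\ell^\infty(\frac1{100}Q)}\big\}\Big|\ \ge\ \varepsilon^3L^2 .$$ (ii) There is a number $0<\varepsilon_1<\frac1{100}$ such that for every $0<\varepsilon\le\varepsilon_1$ there is $\alpha>1$ with the following property. Let $Q$ be a square with $L=\ell(Q)\ge\alpha$, let $\Theta\subset Q$ be $\varepsilon$-regular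 in $Q$, let $\bar V\ge2$, $\lambda_0\in[0,8]$ and $V':\Theta\to\{0,\bar V\}$. Let $\mathcal E$ be the event that, for all $\lambda\in\mathbb R$ and $u:\mathbb Z^2\to\mathbb R$, if $|\lambda-\lambda_0|\le(L\bar V)^{-\alpha L}$, $Hu=\lambda u$ in $Q$, and $|u|\le1$ on at least $(1-\varepsilon^3)|Q\setminus\Theta|$ points of $Q\setminus\Theta$, then $|u|\le(L\bar V)^{\alpha L}$ on $\frac1{100}Q$. Then $$\mathbb P\big[\mathcal E\ \big|\ V|_\Theta=V'\big]\ \ge\ 1-\exp(-\varepsilon L^{2/3}).$$ -/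

import Mathlib

open MeasureTheory ProbabilityTheory

namespace AndersonBernoulli

noncomputable section

/-- The box `Q_l(a)`: the lattice points at sup-distance at most `(l - 1) / 2` from `a`
(the norm of `ℤ × ℤ` is the sup norm). The dilate `k Q_l(a)` is `Q_{kl}(a)`. -/
def box (a : ℤ × ℤ) (l : ℝ) : Set (ℤ × ℤ) :=
  {b | ‖b - a‖ ≤ (l - 1) / 2}

/-- The side length `ℓ(Q_l(a)) = 2 ⌊(l - 1) / 2⌋` of the box `Q_l(a)`. -/
def sideLength (l : ℝ) : ℝ :=
  2 * (⌊(l - 1) / 2⌋ : ℝ)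

/-- The Laplacian of `ℤ²`. -/
def laplacian (u : ℤ × ℤ → ℝ) (a : ℤ × ℤ) : ℝ :=
  u (a + (1, 0)) + u (a - (1, 0)) + u (a + (0, 1)) + u (a - (0, 1)) - 4 * u a

/-- `H u = -Δ u + V u`. -/
def hamiltonian (V u : ℤ × ℤ → ℝ) (a : ℤ × ℤ) : ℝ :=
  -laplacian u a + V a * u a

/-- `H u = lam u` at every point of `S`; `u` is defined on all of `ℤ²`. -/
def IsSolutionOn (V u : ℤ × ℤ → ℝ) (lam : ℝ) (S : Set (ℤ × ℤ)) : Prop :=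
  ∀ a ∈ S, hamiltonian V u a = lam * u a

/-- The norm of `ℓ^∞(S)`, for a finite set `S`. -/
def supNorm (S : Set (ℤ × ℤ)) (u : ℤ × ℤ → ℝ) : ℝ :=
  ⨆ a : S, |u a|

/-- The values `V a`, `a ∈ ℤ²`, are independent random variables, each of which is `0` with
probability `1 / 2` and `Vbar` with probability `1 / 2`. -/
structure IsBernoulliPotential {Ω : Type*} [MeasurableSpace Ω] (P : Measure Ω) (Vbar : ℝ)
    (V : ℤ × ℤ → Ω → ℝ) : Prop where
  measurable : ∀ a, Measurable (V a)
  indep : iIndepFun V P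
  prob_zero : ∀ a, P {ω | V a ω = 0} = 1 / 2
  prob_Vbar : ∀ a, P {ω | V a ω = Vbar} = 1 / 2

/-- `R_{I,J}`: the points `(x, y)` with `x + y ∈ I` and `x - y ∈ J`. -/
def tiltedRect (I J : Set ℤ) : Set (ℤ × ℤ) :=
  {p | p.1 + p.2 ∈ I ∧ p.1 - p.2 ∈ J}

/-- A tilted square is `R_{I,J}` for integer intervals `I`, `J` with equally many elements. -/
def IsTiltedSquare (R : Set (ℤ × ℤ)) : Prop :=
  ∃ (s t : ℤ) (n : ℕ), R = tiltedRect (Set.Ico s (s + n)) (Set.Ico t (t + n))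

/-- The diagonal `x + y = k`. -/
def diagPlus (k : ℤ) : Set (ℤ × ℤ) := {p | p.1 + p.2 = k}

/-- The diagonal `x - y = k`. -/
def diagMinus (k : ℤ) : Set (ℤ × ℤ) := {p | p.1 - p.2 = k}

/-- `Θ` is `η`-sparse in `R`: it has density at most `η` on every diagonal of `R`, in both
directions. -/
def IsSparse (η : ℝ) (Θ R : Set (ℤ × ℤ)) : Prop :=
  (∀ k : ℤ, ((diagPlus k ∩ Θ ∩ R).ncard : ℝ) ≤ η * ((diagPlus k ∩ R).ncard : ℝ)) ∧
  (∀ k : ℤ, ((diagMinus k ∩ Θ ∩ R).ncard : ℝ) ≤ η * ((diagMinus k ∩ R).ncard : ℝ))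

/-- `Θ` is `η`-regular in `E`: disjoint tilted squares in `E`, in none of which `Θ` is
`η`-sparse, have total cardinality at most `η |E|`. -/
def IsRegularIn (η : ℝ) (Θ E : Set (ℤ × ℤ)) : Prop :=
  ∀ (n : ℕ) (R : Fin n → Set (ℤ × ℤ)),
    (∀ i, IsTiltedSquare (R i)) → (∀ i, R i ⊆ E) →
    (∀ i j, i ≠ j → Disjoint (R i) (R j)) → (∀ i, ¬ IsSparse η Θ (R i)) →
    ∑ i, ((R i).ncard : ℝ) ≤ η * (E.ncard : ℝ)

/-- The unique continuation property of the potential `V` in `Q = Q_l(a)`, with `L = ℓ(Q)`: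
each solution of `H u = lam u` in `Q` with `|lam - lam0| ≤ (Vbar L)^(-α L)` satisfies
`|u| ≥ (Vbar L)^(-α L) ‖u‖_{ℓ^∞(Q/100)}` on at least `ε³ L²` points of `Q`. -/
def UniqueContinuation (ε α Vbar lam0 : ℝ) (a : ℤ × ℤ) (l : ℝ) (V : ℤ × ℤ → ℝ) : Prop :=
  ∀ (lam : ℝ) (u : ℤ × ℤ → ℝ),
    |lam - lam0| ≤ (Vbar * sideLength l) ^ (-(α * sideLength l)) →
    IsSolutionOn V u lam (box a l) →
    ε ^ 3 * sideLength l ^ 2 ≤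
      (({b ∈ box a l | (Vbar * sideLength l) ^ (-(α * sideLength l)) *
          supNorm (box a (l / 100)) u ≤ |u b|}).ncard : ℝ)

/-- The unique continuation property of the potential `V` in `Q = Q_l(a)` with frozen set `Θ`,
with `L = ℓ(Q)`: each solution of `H u = lam u` in `Q` with `|lam - lam0| ≤ (L Vbar)^(-α L)` and
`|u| ≤ 1` on a `1 - ε³` fraction of `Q \ Θ` satisfies `|u| ≤ (L Vbar)^(α L)` in `Q/100`. -/
def FrozenUniqueContinuation (ε α Vbar lam0 : ℝ) (a : ℤ × ℤ) (l : ℝ) (Θ : Set (ℤ × ℤ))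
    (V : ℤ × ℤ → ℝ) : Prop :=
  ∀ (lam : ℝ) (u : ℤ × ℤ → ℝ),
    |lam - lam0| ≤ (sideLength l * Vbar) ^ (-(α * sideLength l)) →
    IsSolutionOn V u lam (box a l) →
    (1 - ε ^ 3) * ((box a l \ Θ).ncard : ℝ) ≤ (({b ∈ box a l \ Θ | |u b| ≤ 1}).ncard : ℝ) →
    ∀ b ∈ box a (l / 100), |u b| ≤ (sideLength l * Vbar) ^ (α * sideLength l)

end

end AndersonBernoulli

open AndersonBernoulli

namespace AndersonBernoulli

noncomputable section

/-! ### Solutions in tilted coordinates: row recursions -/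

/-! In the coordinates `x + y`, `x - y` the eigenvalue equation couples each site to the four
corners of a unit cell. On a strip of `b` rows and `a` columns a solution is therefore determined by
two adjacent rows and the first two columns, and propagating it by one row costs a factor of order
`a * Vbar` at most (`TiltedEq.bound`).

The probabilistic input is that a thin strip, `200 b ≤ a`, rarely carries a solution that is small
on its first two rows and on most of its last two rows but huge in between. Given such a solution,
let `t` be the row whose entry in the first two columns is largest relative to a steep geometric
weight. The rows below are then negligible, so row `t` is almost `φ, -φ, φ, ...` on its sublattice,
and its equation expresses the bits of the potential in row `t` through row `t + 1`. That row is
computed from the far end of the strip. Up to a small error it is a linear combination of at most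
`|S| + 2b` vectors that do not depend on the bits of row `t`, where `S` is the exceptional set in
the last two rows. So these bits lie within `1/4` of an affine space of small dimension
(`Inflates.exists_bits`). By the Sauer–Shelah argument (`card_le_of_near_affine`) few bit patterns
do, and only a fraction `2^(-a/4)` of the configurations is bad (`card_inflates_le`).

If no strip around a tilted ball of radius `r` is bad, a bound on `u` in the ball extends to radius
`r + 2 (r / 1000)`, provided the frozen set is sparse there and few free points have `|u| > 1`
(`grow_tball`). Starting from balls of bounded radius on which `|u| ≤ 1`, the growth can stop only
if the starting ball meets a bad or frozen point, the frozen set is not sparse at some scale, bad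
points are dense at some scale, or the potential obstructs. Covering arguments show that the first
three cases exclude few central points. If the fourth excludes at most a quarter of them, some ball
grows until it covers the central cube (`bound_of_few_failures`).

It remains to bound the number of obstructed points (`card_many_failures_le`). At scale `2^s` a
point is obstructed with probability at most `2^(-2^s/4)`, independently over disjoint balls. Among
`N ~ L^2` points one tolerates `N / 8^s` disjoint obstructed balls: they cover a fraction of order
`2^(-s)`, which is summable, and exceeding this number has probability at most `2^(-N^(1/3)/8)`. The
worst case is a single ball of radius about `N^(1/3)`, which is the origin of the exponent `2/3`.

The unfrozen statement follows by taking the frozen set empty and rescaling `u`. -/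

lemma alternating_row_bound {f : ℕ → ℝ} {a : ℕ} {D : ℝ}
    (h : ∀ i, i + 2 < a → |f (i + 2) + f i| ≤ D) (σ k : ℕ) (hk : 2 * k + σ < a) :
    |f (2 * k + σ) - (-1) ^ k * f σ| ≤ k * D := by
  induction k with
  | zero => simp
  | succ k ih =>
    have h1 := ih (by omega)
    have h2 := h (2 * k + σ) (by omega)
    have e : f (2 * (k + 1) + σ) - (-1) ^ (k + 1) * f σ =
        (f (2 * k + σ + 2) + f (2 * k + σ)) - (f (2 * k + σ) - (-1) ^ k * f σ) := by
      rw [show 2 * (k + 1) + σ = 2 * k + σ + 2 by ring]; ring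
    rw [e]
    calc _ ≤ |f (2 * k + σ + 2) + f (2 * k + σ)| + |f (2 * k + σ) - (-1) ^ k * f σ| :=
          abs_sub _ _
      _ ≤ D + k * D := add_le_add h2 h1
      _ = _ := by push_cast; ring

lemma row_bound {f : ℕ → ℝ} {a : ℕ} {D φ : ℝ} (hD : 0 ≤ D)
    (h : ∀ i, i + 2 < a → |f (i + 2) + f i| ≤ D) (h0 : ∀ σ < 2, |f σ| ≤ φ) (i : ℕ) (hi : i < a) :
    |f i| ≤ φ + a * D := by
  have e : 2 * (i / 2) + i % 2 = i := Nat.div_add_mod i 2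
  have h1 := alternating_row_bound h (i % 2) (i / 2) (by omega)
  rw [e] at h1
  have h2 := h0 (i % 2) (Nat.mod_lt _ two_pos)
  have h3 : |(-1 : ℝ) ^ (i / 2) * f (i % 2)| = |f (i % 2)| := by
    rw [abs_mul, abs_pow, abs_neg, abs_one, one_pow, one_mul]
  have h4 : ((i / 2 : ℕ) : ℝ) * D ≤ a * D := by
    apply mul_le_mul_of_nonneg_right _ hD
    exact_mod_cast (by omega : i / 2 ≤ a)
  calc |f i| = |(f i - (-1) ^ (i / 2) * f (i % 2)) + (-1) ^ (i / 2) * f (i % 2)| := by ring_nf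
    _ ≤ _ + _ := abs_add_le _ _
    _ ≤ φ + a * D := by rw [h3]; linarith

/-- `w` solves the tilted equation `w (j+2,i+2) + w (j+2,i) + w (j,i+2) + w (j,i) =
E (j+1,i+1) w (j+1,i+1)` in `[0,b) × [0,a)`, up to an error `δ`. -/
def TiltedEq (a b : ℕ) (E w : ℕ → ℕ → ℝ) (δ : ℝ) : Prop :=
  ∀ j i, j + 2 < b → i + 2 < a →
    |w (j + 2) (i + 2) + w (j + 2) i + w j (i + 2) + w j i - E (j + 1) (i + 1) * w (j + 1) (i + 1)|
      ≤ δ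

/-- Given the rows below, the equation controls sums `w j (i + 2) + w j i`. Summing along the row
from its first two entries costs at most `a (E₀ + 3)`, which is half of `κ`; the other half is left
for the column data. -/
lemma TiltedEq.bound {a b : ℕ} {E w : ℕ → ℕ → ℝ} {δ E₀ κ B : ℝ} (h : TiltedEq a b E w δ)
    (hδ : 0 ≤ δ) (hE₀ : 0 ≤ E₀) (hE : ∀ j i, |E j i| ≤ E₀) (ha : 1 ≤ a)
    (hκ : 2 * a * (E₀ + 3) ≤ κ)
    (hδB : δ ≤ B) (hrow : ∀ j < 2, ∀ i < a, |w j i| ≤ B)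
    (hcol : ∀ j < b, 2 ≤ j → ∀ σ < 2, |w j σ| ≤ B / 2 * κ ^ j) :
    ∀ j < b, ∀ i < a, |w j i| ≤ B * κ ^ j := by
  have ha' : (1 : ℝ) ≤ a := by exact_mod_cast ha
  have hκ1 : 1 ≤ κ := by nlinarith
  have hB : 0 ≤ B := hδ.trans hδB
  intro j
  induction j using Nat.strong_induction_on with
  | _ j ih =>
  intro hj i hi
  by_cases hj2 : j < 2
  · exact (hrow j hj2 i hi).trans (le_mul_of_one_le_right hB (one_le_pow₀ hκ1))
  obtain ⟨j, rfl⟩ : ∃ k, j = k + 2 := ⟨j - 2, by omega⟩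
  have hκj : 0 < κ ^ j := by positivity
  have hone : 1 ≤ κ ^ j := one_le_pow₀ hκ1
  set D : ℝ := (E₀ + 3) * (B * κ ^ (j + 1)) with hD
  have hDpos : 0 ≤ D := by positivity
  have key : ∀ i, i + 2 < a → |w (j + 2) (i + 2) + w (j + 2) i| ≤ D := by
    intro i hi
    have h1 := h j i hj hi
    have h2 := ih j (by omega) (by omega) i (by omega)
    have h3 := ih j (by omega) (by omega) (i + 2) (by omega)
    have h4 := ih (j + 1) (by omega) (by omega) (i + 1) (by omega)
    have h5 : |E (j + 1) (i + 1) * w (j + 1) (i + 1)| ≤ E₀ * (B * κ ^ (j + 1)) := by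
      rw [abs_mul]; exact mul_le_mul (hE _ _) h4 (abs_nonneg _) hE₀
    have h6 : B * κ ^ j ≤ B * κ ^ (j + 1) :=
      mul_le_mul_of_nonneg_left (pow_le_pow_right₀ hκ1 (by omega)) hB
    have h7 : δ ≤ B * κ ^ (j + 1) :=
      hδB.trans (le_mul_of_one_le_right hB (one_le_pow₀ hκ1))
    rw [abs_le] at *
    constructor <;> linarith
  have := row_bound hDpos key (hcol (j + 2) hj (by omega)) i hi
  refine this.trans ?_
  have h8 : (a : ℝ) * D = (2 * a * (E₀ + 3)) * (B / 2 * κ ^ (j + 1)) := by rw [hD]; ring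
  have h9 : (2 * a * (E₀ + 3)) * (B / 2 * κ ^ (j + 1)) ≤ κ * (B / 2 * κ ^ (j + 1)) :=
    mul_le_mul_of_nonneg_right hκ (by positivity)
  rw [h8]
  calc _ ≤ B / 2 * κ ^ (j + 2) + κ * (B / 2 * κ ^ (j + 1)) := by linarith
    _ = _ := by ring

/-- The solution of the tilted equation with data `D` on two rows and two columns. -/
def evolve (E D : ℕ → ℕ → ℝ) : ℕ → ℕ → ℝ
  | 0, i => D 0 i
  | 1, i => D 1 i
  | j + 2, 0 => D (j + 2) 0
  | j + 2, 1 => D (j + 2) 1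
  | j + 2, i + 2 => E (j + 1) (i + 1) * evolve E D (j + 1) (i + 1) - evolve E D (j + 2) i -
      evolve E D j (i + 2) - evolve E D j i
termination_by j i => (j, i)

lemma evolve_row (E D : ℕ → ℕ → ℝ) {j : ℕ} (hj : j < 2) (i : ℕ) : evolve E D j i = D j i := by
  interval_cases j <;> rw [evolve]

lemma evolve_col (E D : ℕ → ℕ → ℝ) (j : ℕ) {i : ℕ} (hi : i < 2) : evolve E D j i = D j i := by
  match j with
  | 0 => rw [evolve]
  | 1 => rw [evolve]
  | j + 2 => interval_cases i <;> rw [evolve]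

lemma evolve_succ (E D : ℕ → ℕ → ℝ) (j i : ℕ) :
    evolve E D (j + 2) (i + 2) + evolve E D (j + 2) i + evolve E D j (i + 2) + evolve E D j i -
      E (j + 1) (i + 1) * evolve E D (j + 1) (i + 1) = 0 := by
  rw [evolve]; ring

lemma evolve_sum {ι : Type*} (E : ℕ → ℕ → ℝ) (Z : Finset ι) (c : ι → ℝ) (D : ι → ℕ → ℕ → ℝ)
    (j i : ℕ) :
    evolve E (fun j i => ∑ z ∈ Z, c z * D z j i) j i = ∑ z ∈ Z, c z * evolve E (D z) j i := by
  induction j using Nat.strong_induction_on generalizing i with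
  | _ j ihj =>
  induction i using Nat.strong_induction_on with
  | _ i ihi =>
  match j, i with
  | 0, i => simp [evolve]
  | 1, i => simp [evolve]
  | j + 2, 0 => simp [evolve]
  | j + 2, 1 => simp [evolve]
  | j + 2, i + 2 =>
    rw [evolve, ihj (j + 1) (by omega), ihi i (by omega), ihj j (by omega), ihj j (by omega)]
    have e : ∀ z, evolve E (D z) (j + 2) (i + 2) = E (j + 1) (i + 1) *
        evolve E (D z) (j + 1) (i + 1) - evolve E (D z) (j + 2) i - evolve E (D z) j (i + 2) -
        evolve E (D z) j i := fun z => by rw [evolve]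
    simp only [e, Finset.mul_sum, ← Finset.sum_sub_distrib]
    exact Finset.sum_congr rfl fun z _ => by ring

/-- Row `n` of the evolution uses only the coefficients of earlier rows. This is the source of the
independence between the bits of a row and the vectors that approximate them. -/
lemma evolve_congr {E E' : ℕ → ℕ → ℝ} (D : ℕ → ℕ → ℝ) {n : ℕ}
    (h : ∀ j < n, ∀ i, E j i = E' j i) (j : ℕ) (hj : j ≤ n) (i : ℕ) :
    evolve E D j i = evolve E' D j i := by
  induction j using Nat.strong_induction_on generalizing i with
  | _ j ihj =>
  induction i using Nat.strong_induction_on with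
  | _ i ihi =>
  match j, i with
  | 0, i => simp [evolve]
  | 1, i => simp [evolve]
  | j + 2, 0 => simp [evolve]
  | j + 2, 1 => simp [evolve]
  | j + 2, i + 2 =>
    rw [evolve, evolve, ihj (j + 1) (by omega) (by omega), ihi i (by omega),
      ihj j (by omega) (by omega), ihj j (by omega) (by omega), h (j + 1) (by omega)]

/-! ### Inflating solutions and the bits of an alternating row -/

/-- The coefficient matrix `E` on the strip `[0,b) × [0,a)` admits a solution with energy shift
`μ`, supported on the even sublattice, that is at most `1` on the first two rows and on most of
the last two rows, but that is large somewhere in the strip. The exceptional set `S` counts rows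
from the last one. -/
def Inflates (K : ℝ) (a b : ℕ) (E : ℕ → ℕ → ℝ) : Prop :=
  ∃ (μ : ℝ) (w : ℕ → ℕ → ℝ) (S : Finset (ℕ × ℕ)),
    |μ| ≤ (K ^ (4 * b + 4))⁻¹ ∧ TiltedEq a b (fun j i => E j i + μ) w 0 ∧
    (∀ j i, ¬ Even (i + j) → w j i = 0) ∧ (∀ j < 2, ∀ i < a, |w j i| ≤ 1) ∧
    S ⊆ Finset.range 2 ×ˢ Finset.range a ∧ 1000 * S.card ≤ a ∧
    (∀ j < 2, ∀ i < a, (j, i) ∉ S → |w (b - 1 - j) i| ≤ 1) ∧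
    ∃ j < b, ∃ i < a, K ^ (3 * b + 3) < |w j i|

/-- The response of the sign-alternated bits of row `t` to a unit datum at `z`. -/
def rowCoeff (E : ℕ → ℕ → ℝ) (Vbar : ℝ) (b t σ : ℕ) (z : ℕ × ℕ) (k : ℕ) : ℝ :=
  (-1) ^ k / Vbar *
    (evolve (fun j i => E (b - 1 - j) i) (fun j i => if z = (j, i) then 1 else 0)
        (b - 2 - t) (2 * k + σ + 1) +
      evolve (fun j i => E (b - 1 - j) i) (fun j i => if z = (j, i) then 1 else 0)
        (b - 2 - t) (2 * k + σ - 1))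

lemma rowCoeff_congr {E E' : ℕ → ℕ → ℝ} {t : ℕ} (h : ∀ j, j ≠ t → ∀ i, E j i = E' j i)
    (Vbar : ℝ) {b : ℕ} (ht : t + 2 < b) (σ : ℕ) (z : ℕ × ℕ) (k : ℕ) :
    rowCoeff E Vbar b t σ z k = rowCoeff E' Vbar b t σ z k := by
  unfold rowCoeff
  rw [evolve_congr (E := fun j i => E (b - 1 - j) i) (E' := fun j i => E' (b - 1 - j) i) _
    (n := b - 2 - t) _ _ le_rfl, evolve_congr (E := fun j i => E (b - 1 - j) i)
    (E' := fun j i => E' (b - 1 - j) i) _ (n := b - 2 - t) _ _ le_rfl] <;>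
  · intro j hj i
    exact h _ (by omega) i

/-- The equation at one site of the alternating row, divided by `s φ Vb`: `N` is the contribution of
the next row, with approximation `Nt`, and `N'` that of the previous row. The errors add up to less
than `c / 4`. -/
lemma bit_error_bound {c Vb Ec φ s N N' w β e μ Nt : ℝ} (hV : 2 ≤ Vb) (hφ : |φ| = c)
    (hc : 0 < c) (hs : s = 1 ∨ s = -1) (hE : Ec = e + Vb * β)
    (heq : (Ec + μ) * w = N + N') (hN' : |N'| ≤ c / 100) (hμw : |μ * w| ≤ c / 100)
    (hEw : |Ec * (w - s * φ)| ≤ c / 100) (hN : |N - Nt| ≤ c / 10) :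
    |β - (-(e / Vb) + s / Vb * Nt / φ)| ≤ 1 / 4 := by
  have hφ0 : φ ≠ 0 := by rintro rfl; simp at hφ; linarith
  have hss : s * s = 1 := by rcases hs with rfl | rfl <;> norm_num
  have hV0 : Vb ≠ 0 := by positivity
  have e1 : (β - (-(e / Vb) + s / Vb * Nt / φ)) * (s * φ * Vb) =
      (N - Nt) + N' - μ * w - Ec * (w - s * φ) := by
    have : (β - (-(e / Vb) + s / Vb * Nt / φ)) * (s * φ * Vb) =
      (e + Vb * β) * (s * φ) - (s * s) * Nt := by field_simp; ring
    rw [this, hss, ← hE]; linarith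
  have hsabs : |s| = 1 := by rcases hs with rfl | rfl <;> norm_num
  have e2 : |β - (-(e / Vb) + s / Vb * Nt / φ)| * (c * Vb) ≤ c / 4 := by
    have : |s * φ * Vb| = c * Vb := by
      rw [abs_mul, abs_mul, hsabs, hφ, abs_of_nonneg (by linarith : 0 ≤ Vb)]; ring
    rw [← this, ← abs_mul, e1]
    rw [abs_le] at *
    constructor <;> linarith
  have h3 : c ≤ c * Vb := by nlinarith
  have h4 := mul_le_mul_of_nonneg_left h3 (abs_nonneg (β - (-(e / Vb) + s / Vb * Nt / φ)))
  have h5 : |β - (-(e / Vb) + s / Vb * Nt / φ)| * c ≤ 1 / 4 * c := by linarith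
  exact le_of_mul_le_mul_right h5 hc

-- An inflating solution must create its size in the first two columns. At the row `t` where this
-- happens relative to the weight `K^(2 t)`, the solution alternates in sign with constant modulus,
-- so the equation there can be solved for the potential. The neighbouring values in row `t + 1`
-- come from the reversed evolution, whose only data that matter lie on `S` and on the first two
-- columns.
set_option maxHeartbeats 1000000 in
theorem Inflates.exists_bits {K Vb e : ℝ} {a b : ℕ} {E β : ℕ → ℕ → ℝ} (h : Inflates K a b E)
    (hV : 2 ≤ Vb) (he : |e| ≤ 4) (hβ : ∀ j i, |β j i| ≤ 1) (hE : ∀ j i, E j i = e + Vb * β j i)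
    (ha : 10 ≤ a) (hK : 100 * a * (Vb + 8) ≤ K) :
    ∃ t σ : ℕ, t + 2 < b ∧ σ < 2 ∧ Even (σ + t) ∧
      ∃ S ⊆ Finset.range 2 ×ˢ Finset.range a, 1000 * S.card ≤ a ∧ ∃ y : ℕ × ℕ → ℝ,
        ∀ k, 1 ≤ k → 2 * k + σ + 1 < a →
          |β t (2 * k + σ) - (-(e / Vb) + ∑ z ∈ S ∪ Finset.range b ×ˢ Finset.range 2,
            y z * rowCoeff E Vb b t σ z k)| ≤ 1 / 4 := by
  obtain ⟨μ, w, S, hμ, heq, hpar, hrow, hSsub, hScard, hlast, jm, hjm, im, him, hbig⟩ := h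
  have haR : (10 : ℝ) ≤ a := by exact_mod_cast ha
  have hK1 : 1 ≤ K := by nlinarith
  have hKbig : 10000 ≤ K := by nlinarith
  have hKV : 1000 * (Vb + 8) ≤ K := by nlinarith
  have hK0 : 0 < K := by linarith
  have hEb : ∀ j i, |E j i| ≤ Vb + 4 := by
    intro j i
    rw [hE]
    calc _ ≤ |e| + |Vb * β j i| := abs_add_le _ _
      _ ≤ 4 + Vb * 1 := by
        rw [abs_mul, abs_of_nonneg (by linarith : 0 ≤ Vb)]
        exact add_le_add he (mul_le_mul_of_nonneg_left (hβ j i) (by linarith))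
      _ = _ := by ring
  have hμK : |μ| * K ^ (4 * b + 4) ≤ 1 := by
    rwa [← le_div_iff₀ (by positivity), one_div]
  have hμ1 : |μ| ≤ 1 := hμ.trans (inv_le_one_of_one_le₀ (one_le_pow₀ hK1))
  have hEμ : ∀ j i, |E j i + μ| ≤ Vb + 5 := fun j i =>
    (abs_add_le _ _).trans (by linarith [hEb j i])
  -- The weight `K^2` per row makes every row below the maximising one smaller by a factor `K^(-2)`,
  -- which beats the factors `a` and `Vb` met later.
  obtain ⟨⟨t, σ⟩, htσ, hmax⟩ := Finset.exists_max_image (Finset.range b ×ˢ Finset.range 2)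
    (fun z => |w z.1 z.2| / (K ^ 2) ^ z.1) ⟨(jm, 0), by simp; omega⟩
  simp only [Finset.mem_product, Finset.mem_range] at htσ hmax
  obtain ⟨ht, hσ⟩ := htσ
  set φ := w t σ with hφ
  set c' := |φ| / (K ^ 2) ^ t with hc'
  have hc'0 : 0 ≤ c' := by positivity
  have hcol : ∀ j < b, ∀ s < 2, |w j s| ≤ c' * (K ^ 2) ^ j := by
    intro j hj s hs
    have := hmax (j, s) ⟨hj, hs⟩
    rwa [div_le_iff₀ (by positivity)] at this
  have hκ : 2 * a * (Vb + 5 + 3) ≤ K ^ 2 := by nlinarith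
  have hall : ∀ B : ℝ, 1 ≤ B → 2 * c' ≤ B → ∀ j < b, ∀ i < a, |w j i| ≤ B * (K ^ 2) ^ j := by
    intro B hB1 hB
    refine heq.bound le_rfl (by linarith) hEμ (by omega) hκ (by linarith)
      (fun j hj i hi => (hrow j hj i hi).trans hB1) ?_
    intro j hj _ s hs
    refine (hcol j hj s hs).trans (mul_le_mul_of_nonneg_right (by linarith) (by positivity))
  -- If the columns stayed below this size, the whole strip would be bounded by `2 K^(b + 2) K^(2
  -- b)`, against the assumed entry above `K^(3 b + 3)`.
  have hc'big : K ^ (b + 2) < c' := by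
    by_contra! hle
    have h1 := hall (2 * K ^ (b + 2)) (by linarith [one_le_pow₀ hK1 (n := b + 2)]) (by linarith)
      jm hjm im him
    have h2 : (K ^ 2) ^ jm ≤ K ^ (2 * b) := by
      rw [← pow_mul]; exact pow_le_pow_right₀ hK1 (by omega)
    have h3 : 2 * K ^ (b + 2) * (K ^ 2) ^ jm ≤ K * K ^ (b + 2) * K ^ (2 * b) := by gcongr; linarith
    have h4 : K * K ^ (b + 2) * K ^ (2 * b) = K ^ (3 * b + 3) := by ring
    linarith
  have hc'1 : 1 < c' := lt_of_le_of_lt (one_le_pow₀ hK1) hc'big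
  set c := |φ| with hc
  have hcc' : c = c' * (K ^ 2) ^ t := by rw [hc']; field_simp
  have hc'c : c' ≤ c := by
    rw [hcc']; exact le_mul_of_one_le_right hc'0 (one_le_pow₀ (one_le_pow₀ hK1))
  have hc0 : 0 < c := by linarith
  have hw := hall (2 * c') (by linarith) le_rfl
  have ht2 : 2 ≤ t := by
    by_contra! hlt
    have := hrow t hlt σ (by omega)
    rw [← hφ, ← hc] at this
    linarith
  have hφ0 : φ ≠ 0 := by
    intro h0; rw [h0] at hc; simp at hc; linarith
  have heven : Even (σ + t) := by
    by_contra hne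
    exact hφ0 (hpar t σ hne)
  obtain ⟨t', rfl⟩ : ∃ k, t = k + 2 := ⟨t - 2, by omega⟩
  -- the row `t` alternates
  have hcQ : c' * (K ^ 2) ^ (t' + 1) = c / K ^ 2 := by rw [hcc']; field_simp; ring
  have hcQ0 : c' * (K ^ 2) ^ t' ≤ c / K ^ 2 := by
    rw [← hcQ]
    exact mul_le_mul_of_nonneg_left (pow_le_pow_right₀ (one_le_pow₀ hK1) (by omega)) hc'0
  set r := c / K ^ 2 with hr
  have hr0 : 0 < r := by positivity
  have hrK : r * K ^ 2 = c := by rw [hr]; field_simp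
  have hrowt : ∀ i, i + 2 < a → |w (t' + 2) (i + 2) + w (t' + 2) i| ≤ (2 * Vb + 14) * r := by
    intro i hi
    have h1 := heq t' i ht hi
    have h2 := hw t' (by omega) i (by omega)
    have h3 := hw t' (by omega) (i + 2) (by omega)
    have h4 := hw (t' + 1) (by omega) (i + 1) (by omega)
    have h5 : |(E (t' + 1) (i + 1) + μ) * w (t' + 1) (i + 1)| ≤ (Vb + 5) * (2 * r) := by
      rw [abs_mul]
      refine mul_le_mul (hEμ _ _) ?_ (abs_nonneg _) (by linarith)
      linarith
    rw [abs_le] at *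
    constructor <;> linarith
  have haD : a * ((2 * Vb + 14) * r) * K ≤ c / 50 := by
    have : (a * (2 * Vb + 14)) ≤ K / 50 := by nlinarith
    calc a * ((2 * Vb + 14) * r) * K = (a * (2 * Vb + 14)) * (r * K) := by ring
      _ ≤ K / 50 * (r * K) := mul_le_mul_of_nonneg_right this (by positivity)
      _ = c / 50 := by rw [← hrK]; ring
  have halt : ∀ k, 2 * k + σ < a →
      |w (t' + 2) (2 * k + σ) - (-1) ^ k * φ| ≤ a * ((2 * Vb + 14) * r) := by
    intro k hk
    refine (alternating_row_bound hrowt σ k hk).trans ?_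
    refine mul_le_mul_of_nonneg_right ?_ (by positivity)
    exact_mod_cast (by omega : k ≤ a)
  have hsign : ∀ k : ℕ, |(-1 : ℝ) ^ k * φ| = c := by
    intro k; rw [abs_mul, abs_pow, abs_neg, abs_one, one_pow, one_mul]
  have haD' : a * ((2 * Vb + 14) * r) ≤ c / 4 := by
    have h0 : 0 ≤ a * ((2 * Vb + 14) * r) := by positivity
    nlinarith
  -- In the last two rows, alternation would make about half of a row larger than `1`, hence
  -- contained in `S`, which is too small.
  have htb : t' + 2 + 2 < b := by
    by_contra! hge
    have hmem : ∀ k, 2 * k + σ < a → (b - 1 - (t' + 2), 2 * k + σ) ∈ S := by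
      intro k hk
      by_contra hns
      have h1 := hlast _ (by omega) _ hk hns
      rw [show b - 1 - (b - 1 - (t' + 2)) = t' + 2 by omega] at h1
      have h2 := halt k hk
      have h3 := hsign k
      have h4 : c ≤ c / 4 + 1 := by
        rw [← h3]
        calc |(-1 : ℝ) ^ k * φ| = |w (t' + 2) (2 * k + σ) -
            (w (t' + 2) (2 * k + σ) - (-1) ^ k * φ)| := by ring_nf
          _ ≤ |w (t' + 2) (2 * k + σ)| + |w (t' + 2) (2 * k + σ) - (-1) ^ k * φ| := abs_sub _ _
          _ ≤ _ := by rw [h3]; linarith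
      have : K ^ (b + 2) ≥ K ^ 1 := pow_le_pow_right₀ hK1 (by omega)
      linarith [pow_one K]
    have hcard : ((Finset.range (a / 2 - 1)).image
        (fun k => (b - 1 - (t' + 2), 2 * k + σ))).card ≤ S.card := by
      refine Finset.card_le_card fun z hz => ?_
      obtain ⟨k, hk, rfl⟩ := Finset.mem_image.1 hz
      exact hmem k (by have := Finset.mem_range.1 hk; omega)
    rw [Finset.card_image_of_injective _ (fun k k' hkk => by simpa using hkk),
      Finset.card_range] at hcard
    omega
  refine ⟨t' + 2, σ, htb, hσ, heven, S, hSsub, hScard,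
    fun z => w (b - 1 - z.1) z.2 / φ, ?_⟩
  -- the comparison solution
  set Z := S ∪ Finset.range b ×ˢ Finset.range 2 with hZ
  set E' : ℕ → ℕ → ℝ := fun j i => E (b - 1 - j) i with hE'
  set D : ℕ → ℕ → ℝ := fun j i => ∑ z ∈ Z, w (b - 1 - z.1) z.2 * (if z = (j, i) then 1 else 0)
    with hD
  have hDval : ∀ j i, (j, i) ∈ Z → D j i = w (b - 1 - j) i := by
    intro j i hji
    simp [hD, hji]
  have hDval' : ∀ j i, (j, i) ∉ Z → D j i = 0 := by
    intro j i hji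
    simp [hD, hji]
  -- The comparison solution ignores the energy shift `μ`; this is the resulting error in the
  -- equation, and the bound `K^(-(4 b + 4))` on `μ` keeps it harmless.
  set δ := |μ| * (2 * c' * (K ^ 2) ^ b) with hδ
  have hδ0 : 0 ≤ δ := by positivity
  set x : ℕ → ℕ → ℝ := fun j i => w (b - 1 - j) i - evolve E' D j i with hx
  have hxeq : TiltedEq a b E' x δ := by
    intro j i hj hi
    have h1 := heq (b - 3 - j) i (by omega) hi
    have h2 := evolve_succ E' D j i
    have h3 := hw (b - 2 - j) (by omega) (i + 1) (by omega)
    have e1 : b - 3 - j + 2 = b - 1 - j := by omega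
    have e2 : b - 3 - j + 1 = b - 2 - j := by omega
    have e3 : b - 1 - (j + 2) = b - 3 - j := by omega
    have e4 : b - 1 - (j + 1) = b - 2 - j := by omega
    rw [e1, e2] at h1
    have h1' := abs_nonpos_iff.1 h1
    simp only [hx, hE', e3, e4] at h2 ⊢
    have : w (b - 3 - j) (i + 2) - evolve (fun j i => E (b - 1 - j) i) D (j + 2) (i + 2) +
        (w (b - 3 - j) i - evolve (fun j i => E (b - 1 - j) i) D (j + 2) i) +
        (w (b - 1 - j) (i + 2) - evolve (fun j i => E (b - 1 - j) i) D j (i + 2)) +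
        (w (b - 1 - j) i - evolve (fun j i => E (b - 1 - j) i) D j i) -
        E (b - 2 - j) (i + 1) *
          (w (b - 2 - j) (i + 1) - evolve (fun j i => E (b - 1 - j) i) D (j + 1) (i + 1)) =
        μ * w (b - 2 - j) (i + 1) := by linear_combination h1' - h2
    rw [this, abs_mul, hδ]
    refine mul_le_mul_of_nonneg_left (h3.trans ?_) (abs_nonneg _)
    exact mul_le_mul_of_nonneg_left (pow_le_pow_right₀ (one_le_pow₀ hK1) (by omega))
      (by linarith)
  -- Now the growth rate is taken to be only `K` per row. The difference `x` has zero column data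
  -- and is at most `1` on the first two reversed rows, so it is at most of order `(1 + δ) K^b`,
  -- small against `c > K^(b + 2)`.
  have hxb := hxeq.bound (E₀ := Vb + 4) (κ := K) (B := 1 + δ) hδ0 (by linarith)
    (fun j i => hEb _ _) (by omega) (by nlinarith) (by linarith)
    (by
      intro j hj i hi
      simp only [hx, evolve_row _ _ hj]
      by_cases hz : (j, i) ∈ Z
      · rw [hDval j i hz, sub_self, abs_zero]; linarith
      · rw [hDval' j i hz, sub_zero]
        have := hlast j hj i hi (fun hs => hz (Finset.mem_union_left _ hs))
        linarith)
    (by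
      intro j hj _ s hs
      have hz : (j, s) ∈ Z := Finset.mem_union_right _ (by simp [hj, hs])
      simp only [hx, evolve_col _ _ _ hs, hDval j s hz, sub_self, abs_zero]
      positivity)
  have hKb : K ^ b * K ^ 2 ≤ c := by rw [← pow_add]; linarith
  have hxsmall : ∀ j < b, ∀ i < a, |x j i| ≤ c / 20 := by
    intro j hj i hi
    refine (hxb j hj i hi).trans ?_
    have h1 : K ^ j ≤ K ^ b := pow_le_pow_right₀ hK1 hj.le
    have h2 : K ^ b ≤ c / 10000 := by
      have h0 : 0 < K ^ b := by positivity
      have h00 : (10000 : ℝ) ≤ K ^ 2 := by nlinarith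
      linarith [mul_le_mul_of_nonneg_left h00 h0.le]
    have h3 : δ * K ^ b ≤ c / 5000 := by
      have e1 : δ * K ^ b * K = 2 * c' * (|μ| * K ^ (3 * b + 1)) := by rw [hδ]; ring
      have e2 : |μ| * K ^ (3 * b + 1) ≤ 1 :=
        le_trans (mul_le_mul_of_nonneg_left (pow_le_pow_right₀ hK1 (by omega)) (abs_nonneg _)) hμK
      have e3 : δ * K ^ b * K ≤ 2 * c := by
        rw [e1]
        linarith [mul_le_mul_of_nonneg_left e2 (by linarith : 0 ≤ 2 * c')]
      have e4 : 0 ≤ δ * K ^ b := by positivity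
      linarith [mul_le_mul_of_nonneg_left hKbig e4]
    calc (1 + δ) * K ^ j ≤ (1 + δ) * K ^ b := mul_le_mul_of_nonneg_left h1 (by linarith)
      _ ≤ c / 20 := by linarith
  intro k hk1 hk
  have hwk := hw (t' + 2) ht (2 * k + σ) (by omega)
  rw [mul_assoc, ← hcc'] at hwk
  have hEC : |E (t' + 2) (2 * k + σ) * (w (t' + 2) (2 * k + σ) - (-1) ^ k * φ)| ≤ c / 100 := by
    rw [abs_mul]
    calc _ ≤ (Vb + 4) * (a * ((2 * Vb + 14) * r)) :=
          mul_le_mul (hEb _ _) (halt k (by omega)) (abs_nonneg _) (by linarith)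
      _ ≤ K / 2 * (a * ((2 * Vb + 14) * r)) :=
          mul_le_mul_of_nonneg_right (by linarith) (by positivity)
      _ ≤ c / 100 := by linarith
  have hμw : |μ * w (t' + 2) (2 * k + σ)| ≤ c / 100 := by
    rw [abs_mul]
    have e2 : |μ| * K ^ 1 ≤ 1 :=
      le_trans (mul_le_mul_of_nonneg_left (pow_le_pow_right₀ hK1 (by omega)) (abs_nonneg _)) hμK
    have e3 : |μ| * 10000 ≤ 1 := by
      rw [pow_one] at e2
      exact (mul_le_mul_of_nonneg_left hKbig (abs_nonneg _)).trans e2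
    calc _ ≤ |μ| * (2 * c) := mul_le_mul_of_nonneg_left hwk (abs_nonneg _)
      _ ≤ _ := by nlinarith
  have hr100 : 4 * r ≤ c / 100 := by
    have : 400 ≤ K ^ 2 := by nlinarith
    nlinarith
  have h1 := heq (t' + 1) (2 * k + σ - 1) (by omega) (by omega)
  have e1 : 2 * k + σ - 1 + 2 = 2 * k + σ + 1 := by omega
  have e2 : 2 * k + σ - 1 + 1 = 2 * k + σ := by omega
  rw [e1, e2] at h1
  have h1' := abs_nonpos_iff.1 h1
  have hn1 := hw (t' + 1) (by omega) (2 * k + σ + 1) (by omega)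
  have hn2 := hw (t' + 1) (by omega) (2 * k + σ - 1) (by omega)
  rw [mul_assoc, hcQ] at hn1 hn2
  have hx1 := hxsmall (b - 2 - (t' + 2)) (by omega) (2 * k + σ + 1) (by omega)
  have hx2 := hxsmall (b - 2 - (t' + 2)) (by omega) (2 * k + σ - 1) (by omega)
  have e5 : b - 1 - (b - 2 - (t' + 2)) = t' + 1 + 2 := by omega
  simp only [hx, e5] at hx1 hx2
  have main := bit_error_bound (c := c) (φ := φ) (s := (-1) ^ k)
    (N := w (t' + 1 + 2) (2 * k + σ + 1) + w (t' + 1 + 2) (2 * k + σ - 1))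
    (N' := w (t' + 1) (2 * k + σ + 1) + w (t' + 1) (2 * k + σ - 1))
    (w := w (t' + 2) (2 * k + σ)) (μ := μ)
    (Nt := evolve E' D (b - 2 - (t' + 2)) (2 * k + σ + 1) +
      evolve E' D (b - 2 - (t' + 2)) (2 * k + σ - 1))
    hV hc.symm hc0 (neg_one_pow_eq_or ℝ k) (hE (t' + 2) (2 * k + σ)) (by linarith)
    ((abs_add_le _ _).trans (by linarith)) hμw hEC
    (by
      rw [abs_le] at *
      constructor <;> linarith)
  convert main using 4
  rw [hD, evolve_sum, evolve_sum, ← Finset.sum_add_distrib, Finset.mul_sum, Finset.sum_div]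
  refine Finset.sum_congr rfl fun z _ => ?_
  simp only [rowCoeff, hE']
  ring

/-! ### Counting -/

/-- Each subset gets the weight `64^(-|s|)`; the total weight is `(1 + 1/64)^|G| ≤ 2^(|G|/32)`, and
small sets have weight at least `64^(-d)`. -/
lemma card_small_subsets {α : Type*} [DecidableEq α] (G : Finset α) (d : ℕ) :
    (({s ∈ G.powerset | s.card ≤ d}.card : ℕ) : ℝ) ≤ 2 ^ ((G.card : ℝ) / 32 + 6 * d) := by
  have h1 := Finset.sum_pow_mul_eq_add_pow (1 / 64 : ℝ) 1 G
  have h2 : (({s ∈ G.powerset | s.card ≤ d}.card : ℕ) : ℝ) * (1 / 64) ^ d ≤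
      (1 / 64 + 1) ^ G.card := by
    rw [← h1, ← nsmul_eq_mul, ← Finset.sum_const]
    refine (Finset.sum_le_sum (g := fun s => (1 / 64 : ℝ) ^ s.card * 1 ^ (G.card - s.card))
      fun s hs => ?_).trans
      (Finset.sum_le_sum_of_subset_of_nonneg (Finset.filter_subset _ _) fun _ _ _ => by positivity)
    rw [one_pow, mul_one]
    exact pow_le_pow_of_le_one (by norm_num) (by norm_num) (Finset.mem_filter.1 hs).2
  have h3 : (1 / 64 + 1 : ℝ) ^ G.card ≤ 2 ^ ((G.card : ℝ) / 32) := by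
    have : (1 / 64 + 1 : ℝ) ≤ 2 ^ (1 / 32 : ℝ) := by
      rw [Real.le_rpow_iff_log_le (by norm_num) (by norm_num)]
      have h4 : Real.log ((1 / 64 + 1) ^ 32) ≤ Real.log 2 :=
        Real.log_le_log (by positivity) (by norm_num)
      rw [Real.log_pow] at h4
      push_cast at h4
      linarith
    calc _ ≤ ((2 : ℝ) ^ (1 / 32 : ℝ)) ^ G.card := pow_le_pow_left₀ (by norm_num) this _
      _ = _ := by rw [← Real.rpow_natCast, ← Real.rpow_mul (by norm_num)]; ring_nf
  have h5 : (2 : ℝ) ^ ((6 : ℝ) * d) = 64 ^ d := by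
    rw [Real.rpow_mul (by norm_num), Real.rpow_natCast]; norm_num
  rw [Real.rpow_add (by norm_num), h5]
  have h6 : (({s ∈ G.powerset | s.card ≤ d}.card : ℕ) : ℝ) =
      (({s ∈ G.powerset | s.card ≤ d}.card : ℕ) : ℝ) * (1 / 64) ^ d * 64 ^ d := by
    rw [mul_assoc, ← mul_pow]; norm_num
  rw [h6]
  exact mul_le_mul_of_nonneg_right (h2.trans h3) (by positivity)

/-- A family of subsets of `G` whose indicators are `1/4`-close to an affine space of dimension
at most `d` has at most as many members as there are subsets of `G` of cardinality at most `d`. -/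
lemma card_le_of_near_affine {α ζ : Type*} [DecidableEq α] {G : Finset α} {Z : Finset ζ}
    (T : ζ → α → ℝ) (e : ℝ) (𝒜 : Finset (Finset α)) (hG : ∀ A ∈ 𝒜, A ⊆ G)
    (h : ∀ A ∈ 𝒜, ∃ y : ζ → ℝ, ∀ g ∈ G,
      |(if g ∈ A then (1 : ℝ) else 0) - (e + ∑ z ∈ Z, y z * T z g)| ≤ 1 / 4) :
    𝒜.card ≤ {s ∈ G.powerset | s.card ≤ Z.card}.card := by
  -- Pajor's form of the Sauer–Shelah lemma: a family has at most as many members as it shatters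
  -- sets, so it suffices that shattered sets have at most `Z.card` points.
  refine 𝒜.card_le_card_shatterer.trans (Finset.card_le_card fun J hJ => ?_)
  rw [Finset.mem_shatterer] at hJ
  have hJG : J ⊆ G := by
    obtain ⟨A, hA, hJA⟩ := hJ.exists_superset
    exact hJA.trans (hG A hA)
  refine Finset.mem_filter.2 ⟨Finset.mem_powerset.2 hJG, ?_⟩
  by_contra! hlt
  -- A shattered set with more than `Z.card` points carries a nonzero `n` orthogonal to all
  -- directions of the affine space.
  let f : (J → ℝ) →ₗ[ℝ] (Z → ℝ) := Matrix.mulVecLin (Matrix.of fun z s => T z.1 s.1)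
  have hker : LinearMap.ker f ≠ ⊥ := LinearMap.ker_ne_bot_of_finrank_lt (by simpa using hlt)
  obtain ⟨n, hn, hn0⟩ := Submodule.exists_mem_ne_zero_of_ne_bot hker
  have hn' : ∀ z ∈ Z, ∑ s : J, n s * T z s = 0 := by
    intro z hz
    have := congrFun (LinearMap.mem_ker.1 hn) ⟨z, hz⟩
    simp only [f, Matrix.mulVecLin_apply, Matrix.mulVec, dotProduct, Matrix.of_apply,
      Pi.zero_apply] at this
    rw [← this]
    exact Finset.sum_congr rfl fun s _ => mul_comm _ _
  have key : ∀ A ∈ 𝒜, |∑ s : J, n s * ((if s.1 ∈ A then (1 : ℝ) else 0) - e)| ≤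
      1 / 4 * ∑ s : J, |n s| := by
    intro A hA
    obtain ⟨y, hy⟩ := h A hA
    have e1 : ∑ s : J, n s * ∑ z ∈ Z, y z * T z s = 0 := by
      simp_rw [Finset.mul_sum]
      rw [Finset.sum_comm]
      refine Finset.sum_eq_zero fun z hz => ?_
      rw [← mul_zero (y z), ← hn' z hz, Finset.mul_sum]
      exact Finset.sum_congr rfl fun s _ => by ring
    have e2 : ∑ s : J, n s * ((if s.1 ∈ A then (1 : ℝ) else 0) - e) =
        ∑ s : J, n s * ((if s.1 ∈ A then (1 : ℝ) else 0) - (e + ∑ z ∈ Z, y z * T z s)) := by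
      rw [← sub_eq_zero, ← Finset.sum_sub_distrib, ← e1]
      exact Finset.sum_congr rfl fun s _ => by ring
    rw [e2, Finset.mul_sum]
    refine (Finset.abs_sum_le_sum_abs _ _).trans (Finset.sum_le_sum fun s _ => ?_)
    rw [abs_mul, mul_comm]
    exact mul_le_mul_of_nonneg_right (hy s (hJG s.2)) (abs_nonneg _)
  have hpos : 0 < ∑ s : J, |n s| := by
    obtain ⟨s, hs⟩ : ∃ s, n s ≠ 0 := by
      by_contra! hall
      exact hn0 (funext hall)
    exact Finset.sum_pos' (fun _ _ => abs_nonneg _) ⟨s, Finset.mem_univ _, abs_pos.2 hs⟩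
  have pick : ∀ p : J → Prop, ∃ A ∈ 𝒜, ∀ s : J, s.1 ∈ A ↔ p s := by
    classical
    intro p
    obtain ⟨A, hA, hAJ⟩ := hJ (t := {s ∈ J | ∃ h : s ∈ J, p ⟨s, h⟩}) (Finset.filter_subset _ _)
    refine ⟨A, hA, fun s => ?_⟩
    have := Finset.ext_iff.1 hAJ s.1
    simpa using this
  -- Choosing the bits by the sign of `n` in both ways gives two values of the pairing with `n` that
  -- differ by the full `ℓ¹` norm, whereas `key` allows only half of it.
  obtain ⟨A, hA, hAp⟩ := pick fun s => 0 < n s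
  obtain ⟨B, hB, hBp⟩ := pick fun s => n s ≤ 0
  have hdiff : ∑ s : J, n s * ((if s.1 ∈ A then (1 : ℝ) else 0) - e) -
      ∑ s : J, n s * ((if s.1 ∈ B then (1 : ℝ) else 0) - e) = ∑ s : J, |n s| := by
    rw [← Finset.sum_sub_distrib]
    refine Finset.sum_congr rfl fun s _ => ?_
    simp only [hAp, hBp]
    rcases lt_or_ge 0 (n s) with hs | hs
    · simp only [hs, if_true, not_le.2 hs, if_false, abs_of_pos hs]; ring
    · simp only [hs, if_true, not_lt.2 hs, if_false, abs_of_nonpos hs]; ring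
  have h1 := abs_le.1 (key A hA)
  have h2 := abs_le.1 (key B hB)
  linarith [h1.2, h2.1]

/-- Conditioning on the bits outside `G`: in each fibre of `A ↦ A \ G` at most `N` choices remain
for `A ∩ G`. -/
lemma card_filter_inter_mem_le {α : Type*} [DecidableEq α] {F G : Finset α} (hGF : G ⊆ F)
    (𝒜 : Finset α → Finset (Finset α)) (N : ℕ) (hN : ∀ A, (𝒜 A).card ≤ N) :
    {A ∈ F.powerset | A ∩ G ∈ 𝒜 (A \ G)}.card ≤ 2 ^ (F.card - G.card) * N := by
  classical
  rw [Finset.card_eq_sum_card_fiberwise (f := fun A => A \ G) (t := (F \ G).powerset)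
    fun A hA => by
      have := Finset.mem_powerset.1 (Finset.mem_filter.1 hA).1
      exact Finset.mem_coe.2 (Finset.mem_powerset.2 (Finset.sdiff_subset_sdiff this le_rfl))]
  calc _ ≤ ∑ _A ∈ (F \ G).powerset, N := by
        refine Finset.sum_le_sum fun A₁ _ => le_trans ?_ (hN A₁)
        refine Finset.card_le_card_of_injOn (fun A => A ∩ G) (fun A hA => ?_) ?_
        · have hA' := Finset.mem_filter.1 (Finset.mem_coe.1 hA)
          have := (Finset.mem_filter.1 hA'.1).2
          rw [hA'.2] at this
          exact this
        · intro A hA B hB hAB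
          have hA' := (Finset.mem_filter.1 (Finset.mem_coe.1 hA)).2
          have hB' := (Finset.mem_filter.1 (Finset.mem_coe.1 hB)).2
          simp only at hAB
          rw [← Finset.sdiff_union_inter A G, ← Finset.sdiff_union_inter B G, hA', hB', hAB]
    _ = _ := by
        rw [Finset.sum_const, Finset.card_powerset, Finset.card_sdiff_of_subset hGF, smul_eq_mul]

/-! ### Counting configurations of the potential -/

/-- The potential that equals `V'` on `Θ`, `Vbar` on `A \ Θ` and `0` elsewhere. -/
def configPotential (Θ : Set (ℤ × ℤ)) (V' : ℤ × ℤ → ℝ) (Vbar : ℝ) (A : Finset (ℤ × ℤ))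
    (p : ℤ × ℤ) : ℝ :=
  open Classical in if p ∈ Θ then V' p else if p ∈ A then Vbar else 0

/-- The coefficients `4 - lam0 + v` in the coordinates `pos` of a strip; the odd sublattice is
irrelevant. -/
def stripCoeff (lam0 : ℝ) (pos : ℕ → ℕ → ℤ × ℤ) (v : ℤ × ℤ → ℝ) (j i : ℕ) : ℝ :=
  4 - lam0 + if Even (i + j) then v (pos j i) else 0

lemma configPotential_eq {Θ : Set (ℤ × ℤ)} {V' : ℤ × ℤ → ℝ} {Vbar : ℝ}
    (hV' : ∀ p ∈ Θ, V' p = 0 ∨ V' p = Vbar) (A : Finset (ℤ × ℤ)) (p : ℤ × ℤ) :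
    configPotential Θ V' Vbar A p = 0 ∨ configPotential Θ V' Vbar A p = Vbar := by
  unfold configPotential
  split_ifs with h h'
  · exact hV' p h
  · exact Or.inr rfl
  · exact Or.inl rfl

set_option maxHeartbeats 1000000 in
open Classical in
/-- The number of configurations that admit an inflating solution on a given strip. -/
theorem card_inflates_le {K Vb lam0 : ℝ} {a b : ℕ} {Θ : Set (ℤ × ℤ)} {V' : ℤ × ℤ → ℝ}
    {pos : ℕ → ℕ → ℤ × ℤ} {F : Finset (ℤ × ℤ)} (hV : 2 ≤ Vb) (hlam : lam0 ∈ Set.Icc (0 : ℝ) 8)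
    (hV' : ∀ p ∈ Θ, V' p = 0 ∨ V' p = Vb) (ha : 100 ≤ a) (hb : 200 * b ≤ a)
    (hK : 100 * a * (Vb + 8) ≤ K)
    (hpos : ∀ j i j' i', Even (i + j) → Even (i' + j') → pos j i = pos j' i' → j = j' ∧ i = i')
    (hF : ∀ j < b, ∀ i < a, Even (i + j) → pos j i ∉ Θ → pos j i ∈ F)
    (hΘ : ∀ j < b, 1000 * {i ∈ Finset.range a | Even (i + j) ∧ pos j i ∈ Θ}.card ≤ a) :
    (({A ∈ F.powerset | Inflates K a b (stripCoeff lam0 pos (configPotential Θ V' Vb A))}.card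
      : ℕ) : ℝ) ≤ 2 ^ ((F.card : ℝ) - a / 4) := by
  have hV0 : 0 < Vb := by linarith
  set β : Finset (ℤ × ℤ) → ℕ → ℕ → ℝ := fun A j i =>
    if Even (i + j) then configPotential Θ V' Vb A (pos j i) / Vb else 0 with hβ
  have hβ1 : ∀ A j i, |β A j i| ≤ 1 := by
    intro A j i
    simp only [hβ]
    split_ifs
    · rcases configPotential_eq hV' A (pos j i) with h | h <;> rw [h]
      · simp
      · rw [div_self hV0.ne']; simp
    · simp
  have hE : ∀ A j i, stripCoeff lam0 pos (configPotential Θ V' Vb A) j i =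
      (4 - lam0) + Vb * β A j i := by
    intro A j i
    simp only [stripCoeff, hβ]
    split_ifs
    · field_simp
    · simp
  have he : |4 - lam0| ≤ 4 := by rw [abs_le]; constructor <;> linarith [hlam.1, hlam.2]
  -- the free points of a row
  set I : ℕ → ℕ → Finset ℕ := fun t σ =>
    {k ∈ Finset.Ico 1 ((a - σ) / 2) | pos t (2 * k + σ) ∉ Θ} with hI
  set G : ℕ → ℕ → Finset (ℤ × ℤ) := fun t σ => (I t σ).image fun k => pos t (2 * k + σ) with hG
  -- The unknown discrete data in the description of the bits, over which a union bound is taken: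
  -- the row, its parity and the exceptional set.
  set Λ : Finset ((ℕ × ℕ) × Finset (ℕ × ℕ)) :=
    {ts ∈ Finset.range b ×ˢ Finset.range 2 | Even (ts.2 + ts.1) ∧ ts.1 + 2 < b} ×ˢ
      {S ∈ (Finset.range 2 ×ˢ Finset.range a).powerset | S.card ≤ a / 1000} with hΛ
  have hinj : ∀ t σ, Even (σ + t) → Function.Injective fun k => pos t (2 * k + σ) := by
    intro t σ hts k k' hkk
    have := (hpos t (2 * k + σ) t (2 * k' + σ) (by rw [add_assoc]; exact (even_two_mul k).add hts)
      (by rw [add_assoc]; exact (even_two_mul k').add hts) hkk).2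
    omega
  have hGcard : ∀ t < b, ∀ σ < 2, Even (σ + t) → (a : ℝ) / 2 - 3 - a / 1000 ≤ (G t σ).card := by
    intro t ht σ hσ hts
    have h1 : (G t σ).card = (I t σ).card := Finset.card_image_of_injective _ (hinj t σ hts)
    have h2 := Finset.card_filter_add_card_filter_not (s := Finset.Ico 1 ((a - σ) / 2))
      (fun k => pos t (2 * k + σ) ∉ Θ)
    have h3 : {k ∈ Finset.Ico 1 ((a - σ) / 2) | ¬ pos t (2 * k + σ) ∉ Θ}.card ≤
        {i ∈ Finset.range a | Even (i + t) ∧ pos t i ∈ Θ}.card := by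
      refine Finset.card_le_card_of_injOn (fun k => 2 * k + σ) (fun k hk => ?_)
        (fun k _ k' _ hkk => by simpa using hkk)
      have hk' := Finset.mem_filter.1 (Finset.mem_coe.1 hk)
      have := Finset.mem_Ico.1 hk'.1
      refine Finset.mem_coe.2 (Finset.mem_filter.2 ⟨Finset.mem_range.2 (show 2 * k + σ < a by omega), ?_,
        not_not.1 hk'.2⟩)
      rw [add_assoc]; exact (even_two_mul k).add hts
    have h4 := hΘ t ht
    rw [Nat.card_Ico] at h2
    have h5 : 500 * a ≤ 1000 * (G t σ).card + 3000 + a := by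
      rw [h1]; simp only [hI]; omega
    have : (500 * a : ℝ) ≤ 1000 * (G t σ).card + 3000 + a := by exact_mod_cast h5
    linarith
  have hGF : ∀ t < b, ∀ σ < 2, Even (σ + t) → G t σ ⊆ F := by
    intro t ht σ hσ hts p hp
    obtain ⟨k, hk, rfl⟩ := Finset.mem_image.1 hp
    have hk' := Finset.mem_filter.1 hk
    have := Finset.mem_Ico.1 hk'.1
    refine hF t ht _ (by omega) ?_ hk'.2
    rw [add_assoc]; exact (even_two_mul k).add hts
  set Z : Finset (ℕ × ℕ) → Finset (ℕ × ℕ) := fun S => S ∪ Finset.range b ×ˢ Finset.range 2 with hZ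
  set ix : ℕ → ℕ → ℤ × ℤ → ℕ := fun t σ =>
    Function.invFun (fun k => pos t (2 * k + σ)) with hix
  set 𝒜 : (ℕ × ℕ) × Finset (ℕ × ℕ) → Finset (ℤ × ℤ) → Finset (Finset (ℤ × ℤ)) := fun l A₁ =>
    {A₂ ∈ (G l.1.1 l.1.2).powerset | ∃ y : ℕ × ℕ → ℝ, ∀ g ∈ G l.1.1 l.1.2,
      |(if g ∈ A₂ then (1 : ℝ) else 0) - (-((4 - lam0) / Vb) + ∑ z ∈ Z l.2, y z *
        rowCoeff (stripCoeff lam0 pos (configPotential Θ V' Vb A₁)) Vb b l.1.1 l.1.2 z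
          (ix l.1.1 l.1.2 g))| ≤ 1 / 4} with h𝒜
  have hsub : {A ∈ F.powerset |
      Inflates K a b (stripCoeff lam0 pos (configPotential Θ V' Vb A))} ⊆
      Λ.biUnion fun l => {A ∈ F.powerset | A ∩ G l.1.1 l.1.2 ∈ 𝒜 l (A \ G l.1.1 l.1.2)} := by
    intro A hA
    obtain ⟨hAF, hinf⟩ := Finset.mem_filter.1 hA
    obtain ⟨t, σ, ht, hσ, hts, S, hS, hScard, y, hy⟩ :=
      hinf.exists_bits hV he (hβ1 A) (hE A) (by omega) hK
    refine Finset.mem_biUnion.2 ⟨((t, σ), S), ?_, Finset.mem_filter.2 ⟨hAF, ?_⟩⟩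
    · simp only [hΛ, Finset.mem_product, Finset.mem_filter, Finset.mem_range, Finset.mem_powerset]
      exact ⟨⟨⟨by omega, hσ⟩, hts, ht⟩, hS, by omega⟩
    · refine Finset.mem_filter.2 ⟨Finset.mem_powerset.2 Finset.inter_subset_right, y, ?_⟩
      intro g hg
      obtain ⟨k, hk, rfl⟩ := Finset.mem_image.1 hg
      have hk' := Finset.mem_filter.1 hk
      have hkI : 1 ≤ k ∧ k < (a - σ) / 2 := Finset.mem_Ico.1 hk'.1
      have hev : Even (2 * k + σ + t) := by rw [add_assoc]; exact (even_two_mul k).add hts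
      have e1 : ix t σ (pos t (2 * k + σ)) = k :=
        Function.leftInverse_invFun (hinj t σ hts) k
      have e2 : (if pos t (2 * k + σ) ∈ A ∩ G t σ then (1 : ℝ) else 0) = β A t (2 * k + σ) := by
        simp only [hβ, if_pos hev, configPotential, if_neg hk'.2, Finset.mem_inter, hg, and_true]
        split_ifs
        · rw [div_self hV0.ne']
        · rw [zero_div]
      -- The approximating vectors do not see row `t`, so they are determined by `A \ G` and may be
      -- held fixed while the bits on `G` vary.
      have e3 : ∀ z, rowCoeff (stripCoeff lam0 pos (configPotential Θ V' Vb (A \ G t σ))) Vb b t σ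
          z k = rowCoeff (stripCoeff lam0 pos (configPotential Θ V' Vb A)) Vb b t σ z k := by
        intro z
        refine rowCoeff_congr (fun j hj i => ?_) Vb ht σ z k
        simp only [stripCoeff]
        split_ifs with hij
        · have : pos j i ∉ G t σ := by
            intro hmem
            obtain ⟨k', hk', hkk⟩ := Finset.mem_image.1 hmem
            refine hj (hpos _ _ _ _ hij ?_ hkk.symm).1
            rw [add_assoc]; exact (even_two_mul k').add hts
          simp [configPotential, this]
        · rfl
      simp only [e1, e2, e3]
      exact hy k hkI.1 (by omega)
  -- Of the entropy of `G`, about `a / 2` bits, a fraction `31 / 32` is lost; `6 |Z|` is paid back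
  -- for the dimension, with `|Z| ≤ |S| + 2 b`.
  have hcard1 : ∀ l ∈ Λ, (({A ∈ F.powerset |
      A ∩ G l.1.1 l.1.2 ∈ 𝒜 l (A \ G l.1.1 l.1.2)}.card : ℕ) : ℝ) ≤
      2 ^ ((F.card : ℝ) - 31 / 32 * (a / 2 - 3 - a / 1000) + 6 * (a / 1000 + 2 * (a / 200))) := by
    rintro ⟨⟨t, σ⟩, S⟩ hl
    simp only [hΛ, Finset.mem_product, Finset.mem_filter, Finset.mem_range,
      Finset.mem_powerset] at hl
    obtain ⟨⟨⟨ht, hσ⟩, hts, _⟩, hS, hScard⟩ := hl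
    have h1 := card_filter_inter_mem_le (hGF t ht σ hσ hts) (𝒜 ((t, σ), S))
      {s ∈ (G t σ).powerset | s.card ≤ (Z S).card}.card fun A₁ =>
        card_le_of_near_affine _ _ _
          (fun A₂ hA₂ => Finset.mem_powerset.1 (Finset.mem_filter.1 hA₂).1)
          (fun A₂ hA₂ => (Finset.mem_filter.1 hA₂).2)
    have h2 := card_small_subsets (G t σ) (Z S).card
    have h3 : ((Z S).card : ℝ) ≤ a / 1000 + 2 * (a / 200) := by
      have h4 : (Z S).card ≤ S.card + b * 2 :=
        (Finset.card_union_le _ _).trans (by simp)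
      have h5 : 1000 * (Z S).card ≤ a + 2 * (5 * a) := by omega
      have : (1000 * (Z S).card : ℝ) ≤ a + 2 * (5 * a) := by exact_mod_cast h5
      linarith
    have h6 := hGcard t ht σ hσ hts
    have h7 : (G t σ).card ≤ F.card := Finset.card_le_card (hGF t ht σ hσ hts)
    calc _ ≤ (((2 ^ (F.card - (G t σ).card) *
          {s ∈ (G t σ).powerset | s.card ≤ (Z S).card}.card : ℕ)) : ℝ) := by exact_mod_cast h1
      _ ≤ 2 ^ ((F.card : ℝ) - (G t σ).card) * 2 ^ (((G t σ).card : ℝ) / 32 + 6 * (Z S).card) := by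
        push_cast
        rw [← Nat.cast_sub h7, Real.rpow_natCast]
        exact mul_le_mul_of_nonneg_left h2 (by positivity)
      _ ≤ _ := by
        rw [← Real.rpow_add (by norm_num)]
        refine Real.rpow_le_rpow_of_exponent_le (by norm_num) ?_
        linarith
  -- The two factors are at most `2^(2 b)` pairs `(t, σ)`, and the subsets with at most `a / 1000`
  -- elements of a set of `2 a` elements.
  have hΛcard : (Λ.card : ℝ) ≤ 2 ^ ((a : ℝ) / 100 + (a / 16 + 6 * (a / 1000))) := by
    rw [hΛ, Finset.card_product, Nat.cast_mul, Real.rpow_add (by norm_num)]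
    refine mul_le_mul ?_ ?_ (by positivity) (by positivity)
    · have h1 : {ts ∈ Finset.range b ×ˢ Finset.range 2 | Even (ts.2 + ts.1) ∧ ts.1 + 2 < b}.card ≤
          2 ^ (b * 2) :=
        (Finset.card_filter_le _ _).trans (by
          rw [Finset.card_product, Finset.card_range, Finset.card_range]
          exact Nat.lt_two_pow_self.le)
      calc _ ≤ (((2 : ℕ) ^ (b * 2) : ℕ) : ℝ) := by exact_mod_cast h1
        _ = (2 : ℝ) ^ ((b * 2 : ℕ) : ℝ) := by rw [Real.rpow_natCast]; push_cast; rfl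
        _ ≤ _ := by
          refine Real.rpow_le_rpow_of_exponent_le (by norm_num) ?_
          have : (200 * b : ℝ) ≤ a := by exact_mod_cast hb
          push_cast; linarith
    · refine (card_small_subsets _ _).trans (Real.rpow_le_rpow_of_exponent_le (by norm_num) ?_)
      rw [Finset.card_product, Finset.card_range, Finset.card_range]
      have : ((a / 1000 : ℕ) : ℝ) ≤ a / 1000 := by
        exact_mod_cast Nat.cast_div_le (α := ℝ) (m := a) (n := 1000)
      push_cast
      linarith
  have haR : (100 : ℝ) ≤ a := by exact_mod_cast ha
  calc _ ≤ ((Λ.biUnion fun l => {A ∈ F.powerset |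
          A ∩ G l.1.1 l.1.2 ∈ 𝒜 l (A \ G l.1.1 l.1.2)}).card : ℝ) := by
        exact_mod_cast Finset.card_le_card hsub
    _ ≤ ∑ l ∈ Λ, (({A ∈ F.powerset |
          A ∩ G l.1.1 l.1.2 ∈ 𝒜 l (A \ G l.1.1 l.1.2)}.card : ℕ) : ℝ) := by
        exact_mod_cast Finset.card_biUnion_le
    _ ≤ Λ.card * 2 ^ ((F.card : ℝ) - 31 / 32 * (a / 2 - 3 - a / 1000) +
          6 * (a / 1000 + 2 * (a / 200))) := by
        rw [← nsmul_eq_mul]; exact Finset.sum_le_card_nsmul _ _ _ hcard1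
    _ ≤ 2 ^ ((a : ℝ) / 100 + (a / 16 + 6 * (a / 1000))) *
          2 ^ ((F.card : ℝ) - 31 / 32 * (a / 2 - 3 - a / 1000) +
          6 * (a / 1000 + 2 * (a / 200))) :=
        mul_le_mul_of_nonneg_right hΛcard (by positivity)
    _ ≤ _ := by
        rw [← Real.rpow_add (by norm_num)]
        refine Real.rpow_le_rpow_of_exponent_le (by norm_num) ?_
        linarith

/-! ### Tilted balls and strips -/

/-- The points whose tilted coordinates `x + y`, `x - y` are within `r` of those of `p`. -/
def tball (p : ℤ × ℤ) (r : ℕ) : Finset (ℤ × ℤ) :=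
  {q ∈ Finset.Icc (p.1 - r) (p.1 + r) ×ˢ Finset.Icc (p.2 - r) (p.2 + r) |
    |q.1 + q.2 - (p.1 + p.2)| ≤ r ∧ |q.1 - q.2 - (p.1 - p.2)| ≤ r}

lemma mem_tball {p q : ℤ × ℤ} {r : ℕ} : q ∈ tball p r ↔
    |q.1 + q.2 - (p.1 + p.2)| ≤ r ∧ |q.1 - q.2 - (p.1 - p.2)| ≤ r := by
  simp only [tball, Finset.mem_filter, Finset.mem_product, Finset.mem_Icc, and_iff_right_iff_imp,
    abs_le]
  omega

lemma tball_mono (p : ℤ × ℤ) {r r' : ℕ} (h : r ≤ r') : tball p r ⊆ tball p r' := by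
  intro q
  simp only [mem_tball, abs_le]
  omega

lemma self_mem_tball (p : ℤ × ℤ) (r : ℕ) : p ∈ tball p r := by
  simp [mem_tball]

lemma coe_tball (p : ℤ × ℤ) (r : ℕ) : (tball p r : Set (ℤ × ℤ)) =
    tiltedRect (Set.Ico (p.1 + p.2 - r) (p.1 + p.2 - r + (2 * r + 1 : ℕ)))
      (Set.Ico (p.1 - p.2 - r) (p.1 - p.2 - r + (2 * r + 1 : ℕ))) := by
  ext q
  simp only [Finset.mem_coe, mem_tball, tiltedRect, Set.mem_ofPred_eq, Set.mem_Ico, abs_le]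
  push_cast
  omega

lemma isTiltedSquare_tball (p : ℤ × ℤ) (r : ℕ) : IsTiltedSquare (tball p r : Set (ℤ × ℤ)) :=
  ⟨_, _, _, coe_tball p r⟩

lemma card_tball_le (p : ℤ × ℤ) (r : ℕ) : (tball p r).card ≤ (2 * r + 1) ^ 2 := by
  refine (Finset.card_filter_le _ _).trans ?_
  rw [Finset.card_product, Int.card_Icc, Int.card_Icc, sq]
  apply le_of_eq
  congr 1 <;> omega

lemma le_card_tball (p : ℤ × ℤ) (r : ℕ) : r ^ 2 ≤ (tball p r).card := by
  have h : Finset.Icc (p.1 - (r / 2 : ℕ)) (p.1 + (r / 2 : ℕ)) ×ˢ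
      Finset.Icc (p.2 - (r / 2 : ℕ)) (p.2 + (r / 2 : ℕ)) ⊆ tball p r := by
    intro q
    simp only [mem_tball, Finset.mem_product, Finset.mem_Icc, abs_le]
    omega
  refine le_trans ?_ (Finset.card_le_card h)
  rw [Finset.card_product, Int.card_Icc, Int.card_Icc, sq]
  apply Nat.mul_le_mul <;> omega

/-- Four isometries of `ℤ²` that turn the direction of growing `x - y` into the four diagonal
directions. -/
def orient : Fin 4 → ℤ × ℤ → ℤ × ℤ
  | 0, q => (q.1, q.2)
  | 1, q => (q.2, q.1)
  | 2, q => (q.1, -q.2)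
  | 3, q => (q.2, -q.1)

lemma orient_injective (g : Fin 4) : Function.Injective (orient g) := by
  rintro ⟨x, y⟩ ⟨x', y'⟩ h
  fin_cases g <;> simp [orient] at h ⊢ <;> tauto

/-- The lattice point with tilted coordinates `s`, `t`. -/
def untilt (s t : ℤ) : ℤ × ℤ := ((s + t) / 2, (s - t) / 2)

/-- The point in column `i` and row `j` of the strip of half-length `ρ` that starts at distance
`r - 2` from `p` in the direction `g`. -/
def stripPos (p : ℤ × ℤ) (g : Fin 4) (r ρ : ℕ) (j i : ℕ) : ℤ × ℤ :=
  p + orient g (untilt (i - ρ) (j + r - 2))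

/-- When `i + j` is even, the tilted coordinates `i - (r + 2 e)` and `j + r - 2` have equal parity,
so the halvings in `untilt` are exact. This is why the half-length is always of the form `r + 2 e`.
-/
lemma stripPos_injective (p : ℤ × ℤ) (g : Fin 4) (r e : ℕ) {j i j' i' : ℕ} (h : Even (i + j))
    (h' : Even (i' + j')) (heq : stripPos p g r (r + 2 * e) j i = stripPos p g r (r + 2 * e) j' i') :
    j = j' ∧ i = i' := by
  have h1 := orient_injective g (add_left_cancel heq)
  simp only [untilt, Prod.mk.injEq] at h1
  obtain ⟨c, hc⟩ := h
  obtain ⟨c', hc'⟩ := h'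
  push_cast at h1
  omega

/-- The coordinate of `q - p` along the strips with direction `g`. -/
def along (g : Fin 4) (p q : ℤ × ℤ) : ℤ :=
  match g with
  | 0 => q.1 + q.2 - (p.1 + p.2)
  | 1 => q.1 + q.2 - (p.1 + p.2)
  | 2 => q.1 - q.2 - (p.1 - p.2)
  | 3 => q.1 - q.2 - (p.1 - p.2)

/-- The coordinate of `q - p` in the direction `g`. -/
def across (g : Fin 4) (p q : ℤ × ℤ) : ℤ :=
  match g with
  | 0 => q.1 - q.2 - (p.1 - p.2)
  | 1 => -(q.1 - q.2 - (p.1 - p.2))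
  | 2 => q.1 + q.2 - (p.1 + p.2)
  | 3 => -(q.1 + q.2 - (p.1 + p.2))

lemma mem_tball_iff (g : Fin 4) {p q : ℤ × ℤ} {r : ℕ} :
    q ∈ tball p r ↔ |along g p q| ≤ r ∧ |across g p q| ≤ r := by
  rw [mem_tball]
  fin_cases g <;> simp only [along, across, abs_neg] <;> tauto

lemma eq_of_along_across (g : Fin 4) {p q q' : ℤ × ℤ} (h : along g p q = along g p q')
    (h' : across g p q = across g p q') : q = q' := by
  obtain ⟨x, y⟩ := q
  obtain ⟨x', y'⟩ := q'
  fin_cases g <;> simp [along, across] at h h' ⊢ <;> omega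

lemma along_stripPos (p : ℤ × ℤ) (g : Fin 4) (r e : ℕ) {j i : ℕ} (h : Even (i + j)) :
    along g p (stripPos p g r (r + 2 * e) j i) = i - (r + 2 * e : ℕ) := by
  obtain ⟨c, hc⟩ := h
  fin_cases g <;>
    simp only [along, stripPos, orient, untilt, Prod.fst_add, Prod.snd_add] <;> push_cast <;> omega

lemma across_stripPos (p : ℤ × ℤ) (g : Fin 4) (r e : ℕ) {j i : ℕ} (h : Even (i + j)) :
    across g p (stripPos p g r (r + 2 * e) j i) = j + r - 2 := by
  obtain ⟨c, hc⟩ := h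
  fin_cases g <;>
    simp only [across, stripPos, orient, untilt, Prod.fst_add, Prod.snd_add] <;> push_cast <;> omega

lemma exists_stripPos {p q : ℤ × ℤ} {g : Fin 4} {r e : ℕ} (h : |along g p q| ≤ (r + 2 * e : ℕ))
    (h' : (r : ℤ) - 2 ≤ across g p q) :
    ∃ j i : ℕ, Even (i + j) ∧ (j : ℤ) = across g p q - r + 2 ∧ i < 2 * (r + 2 * e) + 1 ∧
      q = stripPos p g r (r + 2 * e) j i := by
  rw [abs_le] at h
  have hpar : Even (along g p q + across g p q) := by
    rw [Int.even_iff]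
    fin_cases g <;> simp only [along, across] <;> omega
  obtain ⟨c, hc⟩ := hpar
  have heven : Even ((along g p q + (r + 2 * e : ℕ)).toNat + (across g p q - r + 2).toNat) := by
    rw [Nat.even_iff]; omega
  refine ⟨(across g p q - r + 2).toNat, (along g p q + (r + 2 * e : ℕ)).toNat, heven, by omega,
    by omega, ?_⟩
  apply eq_of_along_across g
  · rw [along_stripPos p g r e heven]; omega
  · rw [across_stripPos p g r e heven]; omega

lemma stripPos_mem_tball (p : ℤ × ℤ) (g : Fin 4) {r e : ℕ} {j i R : ℕ} (h : Even (i + j))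
    (hi : i ≤ 2 * (r + 2 * e)) (hR : r + 2 * e ≤ R) (hj : j + r ≤ R + 2) (hr : 2 ≤ r) :
    stripPos p g r (r + 2 * e) j i ∈ tball p R := by
  rw [mem_tball_iff g, along_stripPos p g r e h, across_stripPos p g r e h, abs_le, abs_le]
  omega

lemma hamiltonian_strip (V u : ℤ × ℤ → ℝ) (p : ℤ × ℤ) (g : Fin 4) (r e : ℕ) {j i : ℕ}
    (h : Even (i + j)) :
    hamiltonian V u (stripPos p g r (r + 2 * e) (j + 1) (i + 1)) =
      (4 + V (stripPos p g r (r + 2 * e) (j + 1) (i + 1))) *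
          u (stripPos p g r (r + 2 * e) (j + 1) (i + 1)) -
        (u (stripPos p g r (r + 2 * e) (j + 2) (i + 2)) +
          u (stripPos p g r (r + 2 * e) (j + 2) i) + u (stripPos p g r (r + 2 * e) j (i + 2)) +
          u (stripPos p g r (r + 2 * e) j i)) := by
  obtain ⟨c, hc⟩ := h
  have e1 : untilt (((i + 2 : ℕ) : ℤ) - (r + 2 * e : ℕ)) (((j + 2 : ℕ) : ℤ) + r - 2) =
      untilt (((i + 1 : ℕ) : ℤ) - (r + 2 * e : ℕ)) (((j + 1 : ℕ) : ℤ) + r - 2) + (1, 0) := by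
    simp only [untilt, Prod.mk_add_mk, Prod.mk.injEq]; push_cast; omega
  have e2 : untilt ((i : ℤ) - (r + 2 * e : ℕ)) (((j + 2 : ℕ) : ℤ) + r - 2) =
      untilt (((i + 1 : ℕ) : ℤ) - (r + 2 * e : ℕ)) (((j + 1 : ℕ) : ℤ) + r - 2) - (0, 1) := by
    simp only [untilt, Prod.mk_sub_mk, Prod.mk.injEq]; push_cast; omega
  have e3 : untilt (((i + 2 : ℕ) : ℤ) - (r + 2 * e : ℕ)) ((j : ℤ) + r - 2) =
      untilt (((i + 1 : ℕ) : ℤ) - (r + 2 * e : ℕ)) (((j + 1 : ℕ) : ℤ) + r - 2) + (0, 1) := by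
    simp only [untilt, Prod.mk_add_mk, Prod.mk.injEq]; push_cast; omega
  have e4 : untilt ((i : ℤ) - (r + 2 * e : ℕ)) ((j : ℤ) + r - 2) =
      untilt (((i + 1 : ℕ) : ℤ) - (r + 2 * e : ℕ)) (((j + 1 : ℕ) : ℤ) + r - 2) - (1, 0) := by
    simp only [untilt, Prod.mk_sub_mk, Prod.mk.injEq]; push_cast; omega
  simp only [stripPos, e1, e2, e3, e4]
  generalize untilt (((i + 1 : ℕ) : ℤ) - (r + 2 * e : ℕ)) (((j + 1 : ℕ) : ℤ) + r - 2) = z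
  obtain ⟨x, y⟩ := z
  obtain ⟨p1, p2⟩ := p
  fin_cases g <;>
    simp [hamiltonian, laplacian, orient, add_assoc, sub_eq_add_neg] <;> ring_nf

/-- A solution that is small on the first two rows of a strip and on most of its last two rows is
controlled on the whole strip, unless the potential admits an inflating solution. -/
lemma strip_bound {K M lam lam0 : ℝ} {V u : ℤ × ℤ → ℝ} {p : ℤ × ℤ} {g : Fin 4} {r e b : ℕ}
    {S : Finset (ℕ × ℕ)} {D : Set (ℤ × ℤ)}
    (hsol : IsSolutionOn V u lam D) (hM : 1 ≤ M)
    (hD : ∀ j < b, ∀ i < 2 * (r + 2 * e) + 1, Even (i + j) →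
      stripPos p g r (r + 2 * e) j i ∈ D)
    (hlam : |lam - lam0| ≤ (K ^ (4 * b + 4))⁻¹)
    (hrow : ∀ j < 2, ∀ i < 2 * (r + 2 * e) + 1, Even (i + j) →
      |u (stripPos p g r (r + 2 * e) j i)| ≤ M)
    (hS : S ⊆ Finset.range 2 ×ˢ Finset.range (2 * (r + 2 * e) + 1))
    (hScard : 1000 * S.card ≤ 2 * (r + 2 * e) + 1)
    (hlast : ∀ j < 2, ∀ i < 2 * (r + 2 * e) + 1, Even (i + (b - 1 - j)) → (j, i) ∉ S →
      |u (stripPos p g r (r + 2 * e) (b - 1 - j) i)| ≤ 1)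
    (hinf : ¬ Inflates K (2 * (r + 2 * e) + 1) b
      (stripCoeff lam0 (stripPos p g r (r + 2 * e)) V)) :
    ∀ j < b, ∀ i < 2 * (r + 2 * e) + 1, Even (i + j) →
      |u (stripPos p g r (r + 2 * e) j i)| ≤ M * K ^ (3 * b + 3) := by
  intro j hj i hi hij
  by_contra! hlt
  have hM0 : 0 < M := by linarith
  apply hinf
  refine ⟨lam0 - lam, fun j i => if Even (i + j) then u (stripPos p g r (r + 2 * e) j i) / M else 0,
    S, by rwa [abs_sub_comm], ?_, fun j i h => if_neg h, ?_, hS, hScard, ?_, j, hj, i, hi, ?_⟩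
  · intro j i hj hi
    refine (abs_nonpos_iff.2 ?_)
    have e1 : Even (i + 2 + (j + 2)) ↔ Even (i + j) := by simp [parity_simps]
    have e2 : Even (i + (j + 2)) ↔ Even (i + j) := by simp [parity_simps]
    have e3 : Even (i + 2 + j) ↔ Even (i + j) := by simp [parity_simps]
    have e4 : Even (i + 1 + (j + 1)) ↔ Even (i + j) := by
      rw [show i + 1 + (j + 1) = i + j + 2 by ring]; simp [parity_simps]
    simp only [e1, e2, e3, e4, stripCoeff]
    split_ifs with h
    · have h1 := hsol _ (hD (j + 1) (by omega) (i + 1) (by omega) (e4.2 h))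
      rw [hamiltonian_strip V u p g r e h] at h1
      field_simp
      linear_combination -h1
    · simp
  · intro j hj i hi
    simp only
    split_ifs with h
    · rw [abs_div, abs_of_pos hM0, div_le_one hM0]
      exact hrow j hj i hi h
    · simp
  · intro j hj i hi hji
    simp only
    split_ifs with h
    · rw [abs_div, abs_of_pos hM0, div_le_one hM0]
      exact (hlast j hj i hi h hji).trans hM
    · simp
  · simp only [if_pos hij]
    rw [abs_div, abs_of_pos hM0, lt_div_iff₀ hM0]
    linarith

/-! ### Growing a tilted ball -/

lemma card_diag_inter_tball (g : Fin 4) (p : ℤ × ℤ) (r : ℕ) (c : ℤ) :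
    {q ∈ tball p r | across g p q = c}.card ≤ 2 * r + 1 := by
  have h := Finset.card_le_card_of_injOn (s := {q ∈ tball p r | across g p q = c})
    (t := Finset.Icc (-(r : ℤ)) r) (along g p) (fun q hq => by
      have := ((mem_tball_iff g).1 (Finset.mem_filter.1 (Finset.mem_coe.1 hq)).1).1
      exact Finset.mem_coe.2 (Finset.mem_Icc.2 (abs_le.1 this)))
    (fun q hq q' hq' h => eq_of_along_across g h
      ((Finset.mem_filter.1 (Finset.mem_coe.1 hq)).2.trans
        (Finset.mem_filter.1 (Finset.mem_coe.1 hq')).2.symm))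
  rw [Int.card_Icc] at h
  omega

lemma IsSparse.card_across_le {η : ℝ} {Θ : Set (ℤ × ℤ)} {p : ℤ × ℤ} {r : ℕ} (hη : 0 ≤ η)
    (h : IsSparse η Θ (tball p r : Set (ℤ × ℤ))) (g : Fin 4) (c : ℤ) :
    open Classical in
    (({q ∈ tball p r | q ∈ Θ ∧ across g p q = c}.card : ℕ) : ℝ) ≤ η * (2 * r + 1) := by
  classical
  obtain ⟨D, hD, hDs⟩ : ∃ D : Set (ℤ × ℤ), (∀ q, across g p q = c ↔ q ∈ D) ∧
      ((D ∩ Θ ∩ tball p r).ncard : ℝ) ≤ η * ((D ∩ tball p r).ncard : ℝ) := by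
    fin_cases g
    · exact ⟨diagMinus (c + (p.1 - p.2)), fun q => by simp [across, diagMinus]; omega, h.2 _⟩
    · exact ⟨diagMinus (-c + (p.1 - p.2)), fun q => by simp [across, diagMinus]; omega, h.2 _⟩
    · exact ⟨diagPlus (c + (p.1 + p.2)), fun q => by simp [across, diagPlus]; omega, h.1 _⟩
    · exact ⟨diagPlus (-c + (p.1 + p.2)), fun q => by simp [across, diagPlus]; omega, h.1 _⟩
  have e1 : (D ∩ Θ ∩ tball p r) =
      (({q ∈ tball p r | q ∈ Θ ∧ across g p q = c} : Finset (ℤ × ℤ)) : Set (ℤ × ℤ)) := by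
    ext q; simp [hD]; tauto
  have e2 : (D ∩ tball p r) =
      (({q ∈ tball p r | across g p q = c} : Finset (ℤ × ℤ)) : Set (ℤ × ℤ)) := by
    ext q; simp [hD]; tauto
  rw [e1, e2, Set.ncard_coe_finset, Set.ncard_coe_finset] at hDs
  refine hDs.trans (mul_le_mul_of_nonneg_left ?_ hη)
  exact_mod_cast card_diag_inter_tball g p r c

-- Each row of a strip lies on one diagonal of the ball of radius `2 r`, where sparsity leaves at
-- most `η (4 r + 1)` points of `Θ`.
open Classical in
lemma IsSparse.card_row_le {η : ℝ} {Θ : Set (ℤ × ℤ)} {p : ℤ × ℤ} {r e j : ℕ} (hη : 0 ≤ η)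
    (hη' : η ≤ 1 / 10 ^ 8) (h : IsSparse η Θ (tball p (2 * r) : Set (ℤ × ℤ))) (g : Fin 4)
    (hr : 2 ≤ r) (he : 2 * e ≤ r) (hj : j ≤ r + 2) :
    10 ^ 7 * {i ∈ Finset.range (2 * (r + 2 * e) + 1) | Even (i + j) ∧
      stripPos p g r (r + 2 * e) j i ∈ Θ}.card ≤ 2 * (r + 2 * e) + 1 := by
  have h1 := h.card_across_le hη g (j + r - 2)
  have h2 : {i ∈ Finset.range (2 * (r + 2 * e) + 1) | Even (i + j) ∧
      stripPos p g r (r + 2 * e) j i ∈ Θ}.card ≤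
      {q ∈ tball p (2 * r) | q ∈ Θ ∧ across g p q = j + r - 2}.card := by
    refine Finset.card_le_card_of_injOn (stripPos p g r (r + 2 * e) j) (fun i hi => ?_) ?_
    · obtain ⟨hi1, hi2, hi3⟩ := Finset.mem_filter.1 (Finset.mem_coe.1 hi)
      have := Finset.mem_range.1 hi1
      exact Finset.mem_coe.2 (Finset.mem_filter.2 ⟨stripPos_mem_tball p g hi2 (by omega)
        (by omega) (by omega) hr, hi3, across_stripPos p g r e hi2⟩)
    · intro i hi i' hi' hii
      exact (stripPos_injective p g r e (Finset.mem_filter.1 (Finset.mem_coe.1 hi)).2.1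
        (Finset.mem_filter.1 (Finset.mem_coe.1 hi')).2.1 hii).2
  have h3 : ((10 ^ 7 * {i ∈ Finset.range (2 * (r + 2 * e) + 1) | Even (i + j) ∧
      stripPos p g r (r + 2 * e) j i ∈ Θ}.card : ℕ) : ℝ) ≤ ((2 * (r + 2 * e) + 1 : ℕ) : ℝ) := by
    have h4 : (({i ∈ Finset.range (2 * (r + 2 * e) + 1) | Even (i + j) ∧
      stripPos p g r (r + 2 * e) j i ∈ Θ}.card : ℕ) : ℝ) ≤ 1 / 10 ^ 8 * (4 * r + 1) := by
      calc _ ≤ _ := by exact_mod_cast h2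
        _ ≤ _ := h1
        _ = η * (4 * r + 1) := by push_cast; ring
        _ ≤ _ := mul_le_mul_of_nonneg_right hη' (by positivity)
    have h5 : (0 : ℝ) ≤ r := by positivity
    have h6 : (0 : ℝ) ≤ e := by positivity
    push_cast at h4 ⊢
    linarith
  exact_mod_cast h3

open Classical in
/-- Two adjacent rows with few points of `B ∪ Θ`. -/
lemma exists_good_rows {η : ℝ} {Θ : Set (ℤ × ℤ)} {p : ℤ × ℤ} {r e : ℕ} (hη : 0 ≤ η)
    (hη' : η ≤ 1 / 10 ^ 8) (h : IsSparse η Θ (tball p (2 * r) : Set (ℤ × ℤ))) (g : Fin 4)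
    (hr : 1000 ≤ r) (he : 2 * e ≤ r) {B : Set (ℤ × ℤ)}
    (hB : 2000000 * {q ∈ tball p (2 * r) | q ∈ B}.card ≤ r ^ 2) :
    ∃ k < r / 1000, ∃ S ⊆ Finset.range 2 ×ˢ Finset.range (2 * (r + 2 * e) + 1),
      1000 * S.card ≤ 2 * (r + 2 * e) + 1 ∧
      ∀ j < 2, ∀ i < 2 * (r + 2 * e) + 1, Even (i + (2 * (r / 1000) + 2 * k + 4 - 1 - j)) →
        (j, i) ∉ S →
        stripPos p g r (r + 2 * e) (2 * (r / 1000) + 2 * k + 4 - 1 - j) i ∉ B ∧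
        stripPos p g r (r + 2 * e) (2 * (r / 1000) + 2 * k + 4 - 1 - j) i ∉ Θ := by
  set a := 2 * (r + 2 * e) + 1 with ha
  set n := r / 1000 with hn
  -- Candidates for the last two rows: the pairs for different `k` are disjoint, and all lie far
  -- enough out for the strip to contain the target radius `r + 2 n`.
  set row : ℕ → ℕ → ℕ := fun k j => 2 * n + 2 * k + 4 - 1 - j with hrow
  set S : Set (ℤ × ℤ) → ℕ → Finset (ℕ × ℕ) := fun C k =>
    {z ∈ Finset.range 2 ×ˢ Finset.range a | Even (z.2 + row k z.1) ∧
      stripPos p g r (r + 2 * e) (row k z.1) z.2 ∈ C} with hS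
  have hΘ : ∀ k < n, 10 ^ 7 * (S Θ k).card ≤ 2 * a := by
    intro k hk
    have h1 : (S Θ k).card ≤ ∑ j ∈ Finset.range 2, {i ∈ Finset.range a | Even (i + row k j) ∧
        stripPos p g r (r + 2 * e) (row k j) i ∈ Θ}.card := by
      rw [Finset.card_eq_sum_card_fiberwise (f := Prod.fst) (t := Finset.range 2) fun z hz =>
        (Finset.mem_product.1 (Finset.mem_filter.1 (Finset.mem_coe.1 hz)).1).1]
      refine Finset.sum_le_sum fun j _ => ?_
      refine Finset.card_le_card_of_injOn Prod.snd (fun z hz => ?_) ?_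
      · obtain ⟨hz1, hz2⟩ := Finset.mem_filter.1 (Finset.mem_coe.1 hz)
        obtain ⟨hz3, hz4⟩ := Finset.mem_filter.1 hz1
        rw [hz2] at hz4
        exact Finset.mem_coe.2 (Finset.mem_filter.2 ⟨(Finset.mem_product.1 hz3).2, hz4⟩)
      · intro z hz z' hz' hzz
        exact Prod.ext ((Finset.mem_filter.1 (Finset.mem_coe.1 hz)).2.trans
          (Finset.mem_filter.1 (Finset.mem_coe.1 hz')).2.symm) hzz
    rw [Finset.sum_range_succ, Finset.sum_range_one] at h1
    have h2 := h.card_row_le hη hη' g (by omega) he (j := row k 0)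
      (by simp only [hrow]; omega)
    have h3 := h.card_row_le hη hη' g (by omega) he (j := row k 1)
      (by simp only [hrow]; omega)
    rw [← ha] at h2 h3
    omega
  -- Pigeonhole: more than `a / 2000` points of `B` in each of the `n` disjoint pairs would exceed
  -- `r^2 / 2000000` in total.
  have hSB : ∃ k < n, 2000 * (S B k).card ≤ a := by
    by_contra! hall
    have h1 : ∑ k ∈ Finset.range n, (S B k).card ≤ {q ∈ tball p (2 * r) | q ∈ B}.card := by
      rw [← Finset.card_sigma]
      refine Finset.card_le_card_of_injOn
        (fun x => stripPos p g r (r + 2 * e) (row x.1 x.2.1) x.2.2) (fun x hx => ?_) ?_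
      · obtain ⟨hx1, hx2⟩ := Finset.mem_sigma.1 (Finset.mem_coe.1 hx)
        obtain ⟨hx3, hx4, hx5⟩ := Finset.mem_filter.1 hx2
        have hx6 := Finset.mem_product.1 hx3
        have hx7 := Finset.mem_range.1 hx6.2
        have hx8 := Finset.mem_range.1 hx1
        exact Finset.mem_coe.2 (Finset.mem_filter.2 ⟨stripPos_mem_tball p g hx4 (by omega)
          (by omega) (by simp only [hrow]; omega) (by omega), hx5⟩)
      · rintro ⟨k, j, i⟩ hx ⟨k', j', i'⟩ hx' hxx
        obtain ⟨hx1, hx2⟩ := Finset.mem_sigma.1 (Finset.mem_coe.1 hx)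
        obtain ⟨hx1', hx2'⟩ := Finset.mem_sigma.1 (Finset.mem_coe.1 hx')
        obtain ⟨hx3, hx4, -⟩ := Finset.mem_filter.1 hx2
        obtain ⟨hx3', hx4', -⟩ := Finset.mem_filter.1 hx2'
        have hj : j < 2 := Finset.mem_range.1 (Finset.mem_product.1 hx3).1
        have hj' : j' < 2 := Finset.mem_range.1 (Finset.mem_product.1 hx3').1
        have := stripPos_injective p g r e hx4 hx4' hxx
        simp only [hrow] at this
        obtain ⟨h1, h2⟩ := this
        have : k = k' ∧ j = j' := by omega
        obtain ⟨rfl, rfl⟩ := this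
        obtain rfl : i = i' := h2
        rfl
    have h2 : n * (a + 1) ≤ ∑ k ∈ Finset.range n, 2000 * (S B k).card := by
      have := Finset.card_nsmul_le_sum (Finset.range n) (fun k => 2000 * (S B k).card) (a + 1)
        fun k hk => hall k (Finset.mem_range.1 hk)
      simpa using this
    rw [← Finset.mul_sum] at h2
    have h3 : r ≤ 2000 * n := by omega
    have h4 : r * (2 * r + 1) ≤ 2000 * n * (a + 1) := Nat.mul_le_mul h3 (by omega)
    nlinarith
  obtain ⟨k, hk, hkB⟩ := hSB
  refine ⟨k, hk, S B k ∪ S Θ k, Finset.union_subset (Finset.filter_subset _ _)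
    (Finset.filter_subset _ _), ?_, ?_⟩
  · have h1 := Finset.card_union_le (S B k) (S Θ k)
    have h2 := hΘ k hk
    omega
  · intro j hj i hi hij hS
    rw [Finset.mem_union, not_or] at hS
    have hmem : (j, i) ∈ Finset.range 2 ×ˢ Finset.range a := by simp [hj, hi]
    exact ⟨fun h => hS.1 (Finset.mem_filter.2 ⟨hmem, hij, h⟩),
      fun h => hS.2 (Finset.mem_filter.2 ⟨hmem, hij, h⟩)⟩

/-- Some strip that is used to grow the tilted ball of radius `r` about `p` admits an inflating
solution. -/
def GrowthObstructed (K lam0 : ℝ) (V : ℤ × ℤ → ℝ) (p : ℤ × ℤ) (r : ℕ) : Prop :=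
  ∃ (g : Fin 4) (c : Fin 2), ∃ k < r / 1000,
    Inflates K (2 * (r + 2 * (c * (r / 1000))) + 1) (2 * (r / 1000) + 2 * k + 4)
      (stripCoeff lam0 (stripPos p g r (r + 2 * (c * (r / 1000)))) V)

open Classical in
/-- Growing a tilted ball in one direction. -/
lemma grow_one_side {K M η lam lam0 : ℝ} {V u : ℤ × ℤ → ℝ} {p : ℤ × ℤ} {r : ℕ}
    {Θ : Set (ℤ × ℤ)} (hη : 0 ≤ η) (hη' : η ≤ 1 / 10 ^ 8)
    (hsparse : IsSparse η Θ (tball p (2 * r) : Set (ℤ × ℤ))) (hr : 1000 ≤ r) (hK : 1 ≤ K)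
    (hM : 1 ≤ M) (hsol : IsSolutionOn V u lam (tball p (2 * r)))
    (hlam : |lam - lam0| ≤ (K ^ r)⁻¹)
    (hB : 2000000 * {q ∈ tball p (2 * r) | q ∉ Θ ∧ 1 < |u q|}.card ≤ r ^ 2)
    (hobs : ¬ GrowthObstructed K lam0 V p r) (g : Fin 4) (c : Fin 2)
    (hrow : ∀ q, |along g p q| ≤ (r + 2 * (c * (r / 1000)) : ℕ) → (r : ℤ) - 2 ≤ across g p q →
      across g p q ≤ r → |u q| ≤ M) (q : ℤ × ℤ)
    (hq : |along g p q| ≤ (r + 2 * (c * (r / 1000)) : ℕ)) (hq' : (r : ℤ) - 2 ≤ across g p q)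
    (hq'' : across g p q ≤ (r + 2 * (r / 1000) : ℕ)) :
    |u q| ≤ M * K ^ (12 * (r / 1000) + 9) := by
  set e := (c : ℕ) * (r / 1000) with he
  have he' : e ≤ r / 1000 := by
    have h1 : (c : ℕ) ≤ 1 := by omega
    calc e ≤ 1 * (r / 1000) := Nat.mul_le_mul_right _ h1
      _ = _ := one_mul _
  obtain ⟨k, hk, S, hSsub, hcard, hgood⟩ := exists_good_rows hη hη' hsparse g hr (by omega : 2 * e ≤ r)
    (B := {q | q ∉ Θ ∧ 1 < |u q|}) (by simpa using hB)
  obtain ⟨j, i, hij, hj, hi, rfl⟩ := exists_stripPos hq hq'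
  have hb := strip_bound (K := K) (M := M) (lam0 := lam0) (g := g) (e := e)
    (b := 2 * (r / 1000) + 2 * k + 4) hsol hM
    (fun j hj i hi hij => Finset.mem_coe.2
      (stripPos_mem_tball p g hij (by omega) (by omega) (by omega) (by omega)))
    (hlam.trans (inv_anti₀ (by positivity) (pow_le_pow_right₀ hK (by omega))))
    (fun j hj i hi hij => hrow _
      (by rw [along_stripPos p g r e hij, abs_le]; omega)
      (by rw [across_stripPos p g r e hij]; omega)
      (by rw [across_stripPos p g r e hij]; omega))
    hSsub hcard
    (fun j hj i hi hij hS => by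
      by_contra! hlt
      exact (hgood j hj i hi hij hS).1 ⟨(hgood j hj i hi hij hS).2, hlt⟩)
    (fun hinf => hobs ⟨g, c, k, hk, hinf⟩) j (by omega) i hi hij
  refine hb.trans (mul_le_mul_of_nonneg_left (pow_le_pow_right₀ hK (by omega)) (by linarith))

open Classical in
/-- Growing a tilted ball. -/
lemma grow_tball {K M η lam lam0 : ℝ} {V u : ℤ × ℤ → ℝ} {p : ℤ × ℤ} {r : ℕ}
    {Θ : Set (ℤ × ℤ)} (hη : 0 ≤ η) (hη' : η ≤ 1 / 10 ^ 8)
    (hsparse : IsSparse η Θ (tball p (2 * r) : Set (ℤ × ℤ))) (hr : 1000 ≤ r) (hK : 1 ≤ K)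
    (hM : 1 ≤ M) (hsol : IsSolutionOn V u lam (tball p (2 * r)))
    (hlam : |lam - lam0| ≤ (K ^ r)⁻¹)
    (hB : 2000000 * {q ∈ tball p (2 * r) | q ∉ Θ ∧ 1 < |u q|}.card ≤ r ^ 2)
    (hobs : ¬ GrowthObstructed K lam0 V p r) (hu : ∀ q ∈ tball p r, |u q| ≤ M) :
    ∀ q ∈ tball p (r + 2 * (r / 1000)), |u q| ≤ M * K ^ (24 * (r / 1000) + 18) := by
  set n := r / 1000 with hn
  set M' := M * K ^ (12 * n + 9) with hM'
  have hMM' : M ≤ M' := le_mul_of_one_le_right (by linarith) (one_le_pow₀ hK)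
  have hM'' : M' * K ^ (12 * n + 9) = M * K ^ (24 * n + 18) := by rw [hM']; ring
  have hM'M : M' ≤ M * K ^ (24 * n + 18) := by
    rw [← hM'']; exact le_mul_of_one_le_right (by linarith) (one_le_pow₀ hK)
  -- The ball is first widened on both sides in the coordinate `x - y`, by strips of half-length
  -- `r`.
  have step1 : ∀ q, |q.1 + q.2 - (p.1 + p.2)| ≤ r →
      |q.1 - q.2 - (p.1 - p.2)| ≤ (r + 2 * n : ℕ) → |u q| ≤ M' := by
    intro q hs ht
    by_cases hin : q ∈ tball p r
    · exact (hu q hin).trans hMM'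
    have hin' : ¬ |q.1 - q.2 - (p.1 - p.2)| ≤ r := fun h => hin (mem_tball.2 ⟨hs, h⟩)
    rw [abs_le] at ht hs
    rw [abs_le] at hin'
    by_cases hpos : 0 ≤ q.1 - q.2 - (p.1 - p.2)
    · refine grow_one_side hη hη' hsparse hr hK hM hsol hlam hB hobs 0 0
        (fun q h1 h2 h3 => hu q ?_) q ?_ ?_ ?_
      · rw [mem_tball_iff 0]; exact ⟨by simpa using h1, abs_le.2 ⟨by omega, h3⟩⟩
      · simp only [along, abs_le]; push_cast; omega
      · simp only [across]; omega
      · simp only [across]; omega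
    · refine grow_one_side hη hη' hsparse hr hK hM hsol hlam hB hobs 1 0
        (fun q h1 h2 h3 => hu q ?_) q ?_ ?_ ?_
      · rw [mem_tball_iff 1]; exact ⟨by simpa using h1, abs_le.2 ⟨by omega, h3⟩⟩
      · simp only [along, abs_le]; push_cast; omega
      · simp only [across]; omega
      · simp only [across]; omega
  intro q hq
  rw [mem_tball] at hq
  obtain ⟨hs, ht⟩ := hq
  by_cases hin : |q.1 + q.2 - (p.1 + p.2)| ≤ r
  · exact (step1 q hin ht).trans hM'M
  rw [← hM'']
  rw [abs_le] at ht hs hin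
  by_cases hpos : 0 ≤ q.1 + q.2 - (p.1 + p.2)
  -- The strips in the other direction span the widened rectangle, hence the longer half-length `c =
  -- 1`; their first rows are bounded by `step1`.
  · refine grow_one_side hη hη' hsparse hr hK (hM.trans hMM') hsol hlam hB hobs 2 1
      (fun q h1 h2 h3 => step1 q ?_ ?_) q ?_ ?_ ?_
    · simp only [across] at h2 h3; rw [abs_le]; omega
    · simp only [along] at h1; rw [abs_le] at h1 ⊢; simp at h1 ⊢; omega
    · simp only [along, abs_le]; push_cast at *; simp; omega
    · simp only [across]; omega
    · simp only [across]; omega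
  · refine grow_one_side hη hη' hsparse hr hK (hM.trans hMM') hsol hlam hB hobs 3 1
      (fun q h1 h2 h3 => step1 q ?_ ?_) q ?_ ?_ ?_
    · simp only [across] at h2 h3; rw [abs_le]; omega
    · simp only [along] at h1; rw [abs_le] at h1 ⊢; simp at h1 ⊢; omega
    · simp only [along, abs_le]; push_cast at *; simp; omega
    · simp only [across]; omega
    · simp only [across]; omega

/-! ### Covering -/

/-- Vitali covering with ratio `2`: a discarded centre lies within `2 r p + 2 r q ≤ 6 r q` of a
selected one, and a ball of radius `6 r` has at most `(12 r + 1)^2 ≤ 169 r^2` points. -/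
lemma exists_disjoint_tballs (P : Finset (ℤ × ℤ)) (r : ℤ × ℤ → ℕ) (hr : ∀ p ∈ P, 1 ≤ r p) :
    ∃ I ⊆ P, (∀ p ∈ I, ∀ q ∈ I, p ≠ q → Disjoint (tball p (2 * r p)) (tball q (2 * r q))) ∧
      P.card ≤ 169 * ∑ p ∈ I, r p ^ 2 := by
  classical
  obtain ⟨I, hIP, hdisj, hcov⟩ := Vitali.exists_disjoint_subfamily_covering_enlargement
    (fun p => (tball p (2 * r p) : Set (ℤ × ℤ))) (P : Set (ℤ × ℤ)) (fun p => (r p : ℝ)) 2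
    one_lt_two (fun p _ => by positivity) ((P.sup r : ℕ) : ℝ)
    (fun p hp => by exact_mod_cast Finset.le_sup (f := r) hp)
    (fun p _ => ⟨p, self_mem_tball _ _⟩)
  lift I to Finset (ℤ × ℤ) using P.finite_toSet.subset hIP
  have hIP' : I ⊆ P := by exact_mod_cast hIP
  refine ⟨I, hIP', fun p hp q hq hpq => ?_, ?_⟩
  · exact Finset.disjoint_coe.1 (hdisj hp hq hpq)
  · have hsub : P ⊆ I.biUnion fun p => tball p (6 * r p) := by
      intro p hp
      obtain ⟨q, hq, ⟨z, hz, hz'⟩, hrr⟩ := hcov p hp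
      have hrr' : r p ≤ 2 * r q := by exact_mod_cast hrr
      refine Finset.mem_biUnion.2 ⟨q, hq, ?_⟩
      simp only [Finset.mem_coe, mem_tball, abs_le] at hz hz' ⊢
      push_cast at *
      omega
    refine (Finset.card_le_card hsub).trans (Finset.card_biUnion_le.trans ?_)
    rw [Finset.mul_sum]
    refine Finset.sum_le_sum fun p hp => (card_tball_le _ _).trans ?_
    have := hr p (hIP' hp)
    nlinarith

lemma IsRegularIn.sum_card_le {η : ℝ} {Θ E : Set (ℤ × ℤ)} (h : IsRegularIn η Θ E)
    {ι : Type*} [DecidableEq ι] (I : Finset ι) (T : ι → Finset (ℤ × ℤ))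
    (hT : ∀ i ∈ I, IsTiltedSquare (T i : Set (ℤ × ℤ)))
    (hE : ∀ i ∈ I, (T i : Set (ℤ × ℤ)) ⊆ E)
    (hdisj : ∀ i ∈ I, ∀ j ∈ I, i ≠ j → Disjoint (T i) (T j))
    (hns : ∀ i ∈ I, ¬ IsSparse η Θ (T i : Set (ℤ × ℤ))) :
    ∑ i ∈ I, ((T i).card : ℝ) ≤ η * (E.ncard : ℝ) := by
  have := h I.card (fun k => (T (I.equivFin.symm k) : Set (ℤ × ℤ))) (fun k => hT _ (Subtype.prop _))
    (fun k => hE _ (Subtype.prop _))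
    (fun k k' hkk => Finset.disjoint_coe.2 (hdisj _ (Subtype.prop _) _ (Subtype.prop _)
      fun h => hkk (I.equivFin.symm.injective (Subtype.ext h))))
    (fun k => hns _ (Subtype.prop _))
  refine le_trans (le_of_eq ?_) this
  rw [Equiv.sum_comp I.equivFin.symm (fun i : I => ((T i : Set (ℤ × ℤ)).ncard : ℝ)),
    ← Finset.sum_coe_sort]
  simp

/-! ### Cubes and the alternatives for a central point -/

/-- The sup-norm ball of radius `n`. -/
def cube (a : ℤ × ℤ) (n : ℕ) : Finset (ℤ × ℤ) :=
  Finset.Icc (a.1 - n) (a.1 + n) ×ˢ Finset.Icc (a.2 - n) (a.2 + n)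

lemma mem_cube {a q : ℤ × ℤ} {n : ℕ} :
    q ∈ cube a n ↔ |q.1 - a.1| ≤ n ∧ |q.2 - a.2| ≤ n := by
  simp only [cube, Finset.mem_product, Finset.mem_Icc, abs_le]
  omega

lemma card_cube (a : ℤ × ℤ) (n : ℕ) : (cube a n).card = (2 * n + 1) ^ 2 := by
  rw [cube, Finset.card_product, Int.card_Icc, Int.card_Icc, sq]
  congr 1 <;> omega

lemma tball_subset_cube {a p : ℤ × ℤ} {m r n : ℕ} (hp : p ∈ cube a m) (h : r + m ≤ n) :
    tball p r ⊆ cube a n := by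
  intro q
  rw [mem_cube, abs_le, abs_le] at hp
  simp only [mem_tball, mem_cube, abs_le]
  omega

/-- Single points are tilted squares of radius `0`, and `Θ` is not `η`-sparse in any of its own
points when `η < 1`. -/
lemma IsRegularIn.card_le {η : ℝ} {Θ Q : Finset (ℤ × ℤ)} (hη : η < 1) (hΘ : Θ ⊆ Q)
    (h : IsRegularIn η Θ (Q : Set (ℤ × ℤ))) : (Θ.card : ℝ) ≤ η * Q.card := by
  have h0 : ∀ p : ℤ × ℤ, tball p 0 = {p} := by
    intro p
    ext q
    simp only [mem_tball, Finset.mem_singleton, Prod.ext_iff, abs_le]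
    omega
  have := h.sum_card_le Θ (fun p => tball p 0) (fun p _ => isTiltedSquare_tball p 0)
    (fun p hp => by rw [h0]; simpa using hΘ hp)
    (fun p _ q _ hpq => by rw [h0, h0]; simpa using hpq)
    (fun p hp hs => by
      have h1 := hs.1 (p.1 + p.2)
      rw [h0] at h1
      have e1 : diagPlus (p.1 + p.2) ∩ ((({p} : Finset (ℤ × ℤ)) : Set (ℤ × ℤ))) = {p} := by
        ext q; simp only [diagPlus]; aesop
      have e2 : diagPlus (p.1 + p.2) ∩ (Θ : Set (ℤ × ℤ)) ∩
          ((({p} : Finset (ℤ × ℤ)) : Set (ℤ × ℤ))) = {p} := by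
        ext q; simp [diagPlus]; rintro rfl; exact ⟨rfl, hp⟩
      rw [e1, e2] at h1
      simp at h1
      linarith)
  simpa [h0, Set.ncard_coe_finset] using this

/-- The potential obstructs growing the ball of some radius in `[k₀, R)` about `p`, although `Θ`
is sparse near `p` at this scale. -/
def Fails (η K lam0 : ℝ) (Θ : Set (ℤ × ℤ)) (V : ℤ × ℤ → ℝ) (k₀ R : ℕ) (p : ℤ × ℤ) : Prop :=
  ∃ r, k₀ ≤ r ∧ r < R ∧ IsSparse η Θ (tball p (2 * r) : Set (ℤ × ℤ)) ∧
    GrowthObstructed K lam0 V p r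

open Classical in
/-- If few central points fail, then a solution that is bounded on most of a cube is bounded on
its central part. -/
theorem bound_of_few_failures {η K lam lam0 : ℝ} {V u : ℤ × ℤ → ℝ} {a : ℤ × ℤ} {n k₀ : ℕ}
    {Θ : Finset (ℤ × ℤ)} (hη : 0 ≤ η) (hη' : η ≤ 1 / 10 ^ 20) (hK : 1 ≤ K)
    (hk₀ : 1000 ≤ k₀) (hk₀' : k₀ ≤ 10 ^ 5) (hn : k₀ < 4 * (n / 100))
    (hΘ : Θ ⊆ cube a n) (hreg : IsRegularIn η Θ (cube a n : Set (ℤ × ℤ)))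
    (hsol : IsSolutionOn V u lam (cube a n : Set (ℤ × ℤ)))
    (hlam : |lam - lam0| ≤ (K ^ n)⁻¹)
    (hbad : (({q ∈ cube a n | q ∉ Θ ∧ 1 < |u q|}.card : ℕ) : ℝ) ≤ η * (cube a n).card)
    (hfail : 4 * {p ∈ cube a (n / 100) | Fails η K lam0 Θ V k₀ (4 * (n / 100)) p}.card ≤
      (cube a (n / 100)).card) :
    ∀ q ∈ cube a (n / 100), |u q| ≤ K ^ (2 * n) := by
  set m := n / 100 with hm
  have h100 : 100 * m ≤ n := by omega
  set B := {q ∈ cube a n | q ∉ Θ ∧ 1 < |u q|} with hB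
  -- The rate `21` is preserved by growing: with `n = r / 1000 ≥ 1` the radius gains `2 n`, and `42
  -- n ≥ 24 n + 18`.
  set nice : ℤ × ℤ → ℕ → Prop := fun p r => ∀ q ∈ tball p r, |u q| ≤ K ^ (21 * r) with hnice
  -- Tilted coordinates of two points of the central cube differ by at most `4 m`, so one such ball
  -- covers the whole cube.
  by_cases hcon : ∃ p ∈ cube a m, ∃ r, 4 * m ≤ r ∧ r ≤ 8 * m ∧ nice p r
  · obtain ⟨p, hp, r, hr1, hr2, hpr⟩ := hcon
    intro q hq
    refine (hpr q ?_).trans (pow_le_pow_right₀ hK (by omega))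
    rw [mem_cube, abs_le, abs_le] at hp hq
    simp only [mem_tball, abs_le]
    omega
  exfalso
  push Not at hcon
  -- the alternatives for a central point
  have halt : ∀ p ∈ cube a m, (∃ q ∈ B ∪ Θ, p ∈ tball q k₀) ∨
      (∃ r, k₀ ≤ r ∧ r < 4 * m ∧ ¬ IsSparse η Θ (tball p (2 * r) : Set (ℤ × ℤ))) ∨
      (∃ r, k₀ ≤ r ∧ r < 4 * m ∧ r ^ 2 < 2000000 * {q ∈ tball p (2 * r) | q ∈ B}.card) ∨
      Fails η K lam0 Θ V k₀ (4 * m) p := by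
    intro p hp
    by_contra! hnot
    obtain ⟨h0, ha, hb, hc⟩ := hnot
    have hstart : nice p k₀ := by
      intro q hq
      have hqB : q ∉ B ∪ Θ := fun h => h0 q h (by
        simp only [mem_tball, abs_le] at hq ⊢; omega)
      rw [Finset.mem_union, not_or] at hqB
      have hqC := tball_subset_cube hp (n := n) (by omega) hq
      have : ¬ (1 < |u q|) := fun h => hqB.1 (Finset.mem_filter.2 ⟨hqC, hqB.2, h⟩)
      exact (not_lt.1 this).trans (one_le_pow₀ hK)
    -- Take the largest nice radius below `4 m`. Growing once more contradicts maximality, or passes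
    -- `4 m` while staying below `8 m` and contradicts `hcon`.
    obtain ⟨r, hr, hrmax⟩ := Finset.exists_max_image
      {r ∈ Finset.range (4 * m) | k₀ ≤ r ∧ nice p r} id
      ⟨k₀, Finset.mem_filter.2 ⟨Finset.mem_range.2 hn, le_rfl, hstart⟩⟩
    obtain ⟨hr1, hr2, hr3⟩ := Finset.mem_filter.1 hr
    have hr4 := Finset.mem_range.1 hr1
    have hTsub : tball p (2 * r) ⊆ cube a n := tball_subset_cube hp (by omega)
    have hBr : {q ∈ tball p (2 * r) | q ∉ (Θ : Set (ℤ × ℤ)) ∧ 1 < |u q|} =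
        {q ∈ tball p (2 * r) | q ∈ B} := by
      ext q
      simp only [Finset.mem_filter, hB, Finset.mem_coe]
      constructor
      · rintro ⟨h1, h2⟩; exact ⟨h1, hTsub h1, h2⟩
      · rintro ⟨h1, -, h2⟩; exact ⟨h1, h2⟩
    have hgrow := grow_tball hη (hη'.trans (by norm_num)) (ha r hr2 hr4) (by omega) hK
      (one_le_pow₀ hK (n := 21 * r)) (fun q hq => hsol q (hTsub hq))
      (hlam.trans (inv_anti₀ (by positivity) (pow_le_pow_right₀ hK (by omega))))
      (le_trans (le_of_eq (by rw [← hBr]; congr!)) (hb r hr2 hr4)) (fun hobs => hc ⟨r, hr2, hr4, ha r hr2 hr4, hobs⟩) hr3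
    have hnext : nice p (r + 2 * (r / 1000)) := by
      intro q hq
      refine (hgrow q hq).trans ?_
      rw [← pow_add]
      exact pow_le_pow_right₀ hK (by omega)
    by_cases hlt : r + 2 * (r / 1000) < 4 * m
    · have := hrmax (r + 2 * (r / 1000))
        (Finset.mem_filter.2 ⟨Finset.mem_range.2 hlt, by omega, hnext⟩)
      simp only [id] at this
      omega
    · exact hcon p hp _ (by omega) (by omega) hnext
  choose! ra hra using fun (p : ℤ × ℤ) (h : ∃ r, k₀ ≤ r ∧ r < 4 * m ∧
    ¬ IsSparse η Θ (tball p (2 * r) : Set (ℤ × ℤ))) => h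
  choose! rb hrb using fun (p : ℤ × ℤ) (h : ∃ r, k₀ ≤ r ∧ r < 4 * m ∧
    r ^ 2 < 2000000 * {q ∈ tball p (2 * r) | q ∈ B}.card) => h
  set C₀ := (B ∪ Θ).biUnion fun q => tball q k₀ with hC₀
  set Ca := {p ∈ cube a m | ∃ r, k₀ ≤ r ∧ r < 4 * m ∧
    ¬ IsSparse η Θ (tball p (2 * r) : Set (ℤ × ℤ))} with hCa
  set Cb := {p ∈ cube a m | ∃ r, k₀ ≤ r ∧ r < 4 * m ∧
    r ^ 2 < 2000000 * {q ∈ tball p (2 * r) | q ∈ B}.card} with hCb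
  set Cc := {p ∈ cube a m | Fails η K lam0 Θ V k₀ (4 * m) p} with hCc
  have hcover : cube a m ⊆ C₀ ∪ (Ca ∪ (Cb ∪ Cc)) := by
    intro p hp
    simp only [Finset.mem_union]
    rcases halt p hp with ⟨q, hq, hpq⟩ | h | h | h
    · exact Or.inl (Finset.mem_biUnion.2 ⟨q, hq, hpq⟩)
    · exact Or.inr (Or.inl (Finset.mem_filter.2 ⟨hp, h⟩))
    · exact Or.inr (Or.inr (Or.inl (Finset.mem_filter.2 ⟨hp, h⟩)))
    · exact Or.inr (Or.inr (Or.inr (Finset.mem_filter.2 ⟨hp, h⟩)))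
  have hcard : (cube a m).card ≤ C₀.card + (Ca.card + (Cb.card + Cc.card)) :=
    (Finset.card_le_card hcover).trans ((Finset.card_union_le _ _).trans (Nat.add_le_add_left
      ((Finset.card_union_le _ _).trans (Nat.add_le_add_left (Finset.card_union_le _ _) _)) _))
  set N : ℝ := ((cube a n).card : ℝ) with hN
  have hN0 : 0 ≤ N := by positivity
  have hC₀card : (C₀.card : ℝ) ≤ 10 ^ 12 * (2 * (η * N)) := by
    have h1 : C₀.card ≤ (B.card + Θ.card) * 10 ^ 12 := by
      refine Finset.card_biUnion_le.trans ((Finset.sum_le_card_nsmul _ _ (10 ^ 12) fun q _ =>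
        (card_tball_le q k₀).trans ?_).trans ?_)
      · calc (2 * k₀ + 1) ^ 2 ≤ (10 ^ 6) ^ 2 := Nat.pow_le_pow_left (by omega) 2
          _ = _ := by norm_num
      · rw [smul_eq_mul]; exact Nat.mul_le_mul_right _ (Finset.card_union_le _ _)
    have h2 : (C₀.card : ℝ) ≤ (B.card + Θ.card) * 10 ^ 12 := by exact_mod_cast h1
    have h3 := hreg.card_le (hη'.trans_lt (by norm_num)) hΘ
    linarith
  have hCacard : (Ca.card : ℝ) ≤ 169 * (η * N) := by
    obtain ⟨I, hI, hdisj, hIcard⟩ := exists_disjoint_tballs Ca ra fun p hp => by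
      have := hra p (Finset.mem_filter.1 hp).2
      omega
    have hI' : ∀ p ∈ I, p ∈ cube a m ∧ k₀ ≤ ra p ∧ ra p < 4 * m ∧
        ¬ IsSparse η Θ (tball p (2 * ra p) : Set (ℤ × ℤ)) := fun p hp =>
      ⟨(Finset.mem_filter.1 (hI hp)).1, hra p (Finset.mem_filter.1 (hI hp)).2⟩
    have h1 := hreg.sum_card_le I (fun p => tball p (2 * ra p))
      (fun p _ => isTiltedSquare_tball _ _)
      (fun p hp => Finset.coe_subset.2 (tball_subset_cube (hI' p hp).1 (by
        have := (hI' p hp).2.2.1; omega)))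
      hdisj (fun p hp => (hI' p hp).2.2.2)
    rw [Set.ncard_coe_finset] at h1
    have h2 : ((∑ p ∈ I, ra p ^ 2 : ℕ) : ℝ) ≤ ∑ p ∈ I, ((tball p (2 * ra p)).card : ℝ) := by
      rw [← Nat.cast_sum]
      exact_mod_cast Finset.sum_le_sum fun p _ =>
        (Nat.pow_le_pow_left (by omega : ra p ≤ 2 * ra p) 2).trans (le_card_tball p (2 * ra p))
    have h3 : (Ca.card : ℝ) ≤ 169 * ((∑ p ∈ I, ra p ^ 2 : ℕ) : ℝ) := by exact_mod_cast hIcard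
    linarith
  -- The selected balls are disjoint and each contains more than `rb^2 / 2000000` points of `B`, so
  -- `B` controls the covered volume.
  have hCbcard : (Cb.card : ℝ) ≤ 169 * 2000000 * (η * N) := by
    obtain ⟨I, hI, hdisj, hIcard⟩ := exists_disjoint_tballs Cb rb fun p hp => by
      have := hrb p (Finset.mem_filter.1 hp).2
      omega
    have h1 : ∑ p ∈ I, rb p ^ 2 ≤ 2000000 * B.card := by
      calc ∑ p ∈ I, rb p ^ 2 ≤ ∑ p ∈ I, 2000000 * {q ∈ tball p (2 * rb p) | q ∈ B}.card :=
            Finset.sum_le_sum fun p hp => (hrb p (Finset.mem_filter.1 (hI hp)).2).2.2.le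
        _ = 2000000 * (I.biUnion fun p => {q ∈ tball p (2 * rb p) | q ∈ B}).card := by
            rw [← Finset.mul_sum, Finset.card_biUnion]
            intro p hp q hq hpq
            exact Finset.disjoint_filter_filter (hdisj p hp q hq hpq)
        _ ≤ _ := by
            refine Nat.mul_le_mul_left _ (Finset.card_le_card fun q hq => ?_)
            obtain ⟨p, -, hq⟩ := Finset.mem_biUnion.1 hq
            exact (Finset.mem_filter.1 hq).2
    have h2 : (Cb.card : ℝ) ≤ 169 * (2000000 * B.card) := by
      exact_mod_cast hIcard.trans (Nat.mul_le_mul_left 169 h1)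
    linarith
  have hNm : N ≤ 40000 * ((cube a m).card : ℝ) := by
    have h1 : (cube a n).card ≤ 40000 * (cube a m).card := by
      rw [card_cube, card_cube]
      calc (2 * n + 1) ^ 2 ≤ (200 * (2 * m + 1)) ^ 2 := Nat.pow_le_pow_left (by omega) 2
        _ = _ := by ring
    rw [hN]
    exact_mod_cast h1
  have hpos : (1 : ℝ) ≤ (cube a m).card := by
    have : 1 ≤ (cube a m).card := by rw [card_cube]; exact Nat.one_le_pow _ _ (by omega)
    exact_mod_cast this
  have hηN : η * N ≤ 1 / 10 ^ 20 * (40000 * ((cube a m).card : ℝ)) :=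
    mul_le_mul hη' hNm hN0 (by norm_num)
  have hcardR : ((cube a m).card : ℝ) ≤ C₀.card + (Ca.card + (Cb.card + Cc.card)) := by
    exact_mod_cast hcard
  have hfailR : 4 * (Cc.card : ℝ) ≤ (cube a m).card := by exact_mod_cast hfail
  linarith

/-! ### Large deviations -/

lemma Inflates.congr {K : ℝ} {a b : ℕ} {E E' : ℕ → ℕ → ℝ} (h : Inflates K a b E)
    (hE : ∀ j < b, ∀ i < a, E j i = E' j i) : Inflates K a b E' := by
  obtain ⟨μ, w, S, h1, h2, h3⟩ := h
  refine ⟨μ, w, S, h1, fun j i hj hi => ?_, h3⟩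
  have := h2 j i hj hi
  simp only at this ⊢
  rwa [hE (j + 1) (by omega) (i + 1) (by omega)] at this

lemma stripPos_mem_tball_two_mul (p : ℤ × ℤ) (g : Fin 4) (c : Fin 2) {r k i j : ℕ}
    (hr : 1000 ≤ r) (hk : k < r / 1000) (hj : j < 2 * (r / 1000) + 2 * k + 4)
    (hi : i < 2 * (r + 2 * (c * (r / 1000))) + 1) (h : Even (i + j)) :
    stripPos p g r (r + 2 * (c * (r / 1000))) j i ∈ tball p (2 * r) := by
  have h1 : (c : ℕ) * (r / 1000) ≤ 1 * (r / 1000) := Nat.mul_le_mul_right _ (by omega)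
  exact stripPos_mem_tball p g h (by omega) (by omega) (by omega) (by omega)

/-- Failure is a local event: the strips involved stay inside the ball of radius `2 R`. Hence
failures with disjoint balls are independent. -/
lemma Fails.congr {η K lam0 : ℝ} {Θ : Set (ℤ × ℤ)} {V V' : ℤ × ℤ → ℝ} {k₀ R : ℕ} {p : ℤ × ℤ}
    (hk₀ : 1000 ≤ k₀) (h : Fails η K lam0 Θ V k₀ R p)
    (hV : ∀ q ∈ tball p (2 * R), V q = V' q) : Fails η K lam0 Θ V' k₀ R p := by
  obtain ⟨r, hr1, hr2, hs, g, c, k, hk, hinf⟩ := h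
  refine ⟨r, hr1, hr2, hs, g, c, k, hk, hinf.congr fun j hj i hi => ?_⟩
  simp only [stripCoeff]
  split_ifs with hij
  · rw [hV _ (tball_mono p (by omega)
      (stripPos_mem_tball_two_mul p g c (by omega) hk hj hi hij))]
  · rfl

open Classical in
/-- The number of configurations for which `p` fails at a dyadic scale. -/
lemma card_fails_le {η K Vb lam0 : ℝ} {n s : ℕ} {Θ : Set (ℤ × ℤ)} {V' : ℤ × ℤ → ℝ}
    {F : Finset (ℤ × ℤ)} {p : ℤ × ℤ} (hη : 0 ≤ η) (hη' : η ≤ 1 / 10 ^ 8) (hV : 2 ≤ Vb)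
    (hlam : lam0 ∈ Set.Icc (0 : ℝ) 8) (hV' : ∀ p ∈ Θ, V' p = 0 ∨ V' p = Vb)
    (hK : 100 * n * (Vb + 8) ≤ K) (hs : 13 ≤ s) (hsn : 8 * 2 ^ s ≤ n)
    (hF : ∀ q ∈ tball p (2 * 2 ^ (s + 1)), q ∉ Θ → q ∈ F) :
    (({A ∈ F.powerset | Fails η K lam0 Θ (configPotential Θ V' Vb A) (2 ^ s) (2 ^ (s + 1)) p}.card
      : ℕ) : ℝ) ≤ 2 ^ (-((2 : ℝ) ^ s / 4)) * 2 ^ F.card := by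
  have h2s : 2 ^ 13 ≤ 2 ^ s := Nat.pow_le_pow_right (by norm_num) hs
  have h2s' : 2 ^ (s + 1) = 2 * 2 ^ s := by ring
  set Λ : Finset (((ℕ × Fin 4) × Fin 2) × ℕ) :=
    {l ∈ ((Finset.Ico (2 ^ s) (2 ^ (s + 1)) ×ˢ Finset.univ) ×ˢ Finset.univ) ×ˢ
      Finset.range (2 ^ (s + 1) / 1000) | l.2 < l.1.1.1 / 1000 ∧
        IsSparse η Θ (tball p (2 * l.1.1.1) : Set (ℤ × ℤ))} with hΛ
  set X : ((ℕ × Fin 4) × Fin 2) × ℕ → Finset (Finset (ℤ × ℤ)) := fun l =>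
    {A ∈ F.powerset | Inflates K (2 * (l.1.1.1 + 2 * (l.1.2 * (l.1.1.1 / 1000))) + 1)
      (2 * (l.1.1.1 / 1000) + 2 * l.2 + 4)
      (stripCoeff lam0 (stripPos p l.1.1.2 l.1.1.1 (l.1.1.1 + 2 * (l.1.2 * (l.1.1.1 / 1000))))
        (configPotential Θ V' Vb A))} with hX
  have hsub : {A ∈ F.powerset |
      Fails η K lam0 Θ (configPotential Θ V' Vb A) (2 ^ s) (2 ^ (s + 1)) p} ⊆ Λ.biUnion X := by
    intro A hA
    obtain ⟨hA1, r, hr1, hr2, hsp, g, c, k, hk, hinf⟩ := Finset.mem_filter.1 hA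
    refine Finset.mem_biUnion.2 ⟨(((r, g), c), k), ?_, Finset.mem_filter.2 ⟨hA1, hinf⟩⟩
    simp only [hΛ, Finset.mem_filter, Finset.mem_product, Finset.mem_Ico, Finset.mem_univ,
      Finset.mem_range, and_true]
    exact ⟨⟨⟨hr1, hr2⟩, by omega⟩, hk, hsp⟩
  have hXcard : ∀ l ∈ Λ, ((X l).card : ℝ) ≤ 2 ^ ((F.card : ℝ) - 2 ^ s / 2) := by
    rintro ⟨⟨⟨r, g⟩, c⟩, k⟩ hl
    simp only [hΛ, Finset.mem_filter, Finset.mem_product, Finset.mem_Ico, Finset.mem_univ,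
      Finset.mem_range, and_true] at hl
    obtain ⟨⟨⟨hr1, hr2⟩, -⟩, hk, hsp⟩ := hl
    have h1 : (c : ℕ) * (r / 1000) ≤ 1 * (r / 1000) := Nat.mul_le_mul_right _ (by omega)
    have h2 := card_inflates_le (K := K) (a := 2 * (r + 2 * (c * (r / 1000))) + 1)
      (b := 2 * (r / 1000) + 2 * k + 4) (F := F)
      (pos := stripPos p g r (r + 2 * (c * (r / 1000)))) hV hlam hV' (by omega) (by omega)
      (le_trans (by
        have h3 : 2 * (r + 2 * ((c : ℕ) * (r / 1000))) + 1 ≤ n := by omega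
        have h4 : ((2 * (r + 2 * ((c : ℕ) * (r / 1000))) + 1 : ℕ) : ℝ) ≤ n := by exact_mod_cast h3
        have h5 : 0 ≤ Vb + 8 := by linarith
        gcongr) hK)
      (fun j i j' i' h h' heq => stripPos_injective p g r _ h h' heq)
      (fun j hj i hi hij hΘ => hF _ (tball_mono p (by omega)
        (stripPos_mem_tball_two_mul p g c (by omega) hk hj hi hij)) hΘ)
      (fun j hj => by
        have := hsp.card_row_le hη hη' g (by omega : 2 ≤ r)
          (e := c * (r / 1000)) (j := j) (by omega) (by omega)
        omega)
    -- The strips have `a ≥ 2 * 2^s` columns. Half of the gain `2^s / 2` is later spent on the union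
    -- bound over the at most `2^(2 s)` strips.
    refine h2.trans (Real.rpow_le_rpow_of_exponent_le (by norm_num) ?_)
    have h3 : 2 * 2 ^ s ≤ 2 * (r + 2 * ((c : ℕ) * (r / 1000))) + 1 := by omega
    have h4 : (2 * 2 ^ s : ℝ) ≤ ((2 * (r + 2 * ((c : ℕ) * (r / 1000))) + 1 : ℕ) : ℝ) := by
      exact_mod_cast h3
    linarith
  have hΛcard : (Λ.card : ℝ) ≤ 2 ^ ((2 : ℝ) * s) := by
    have h1 : Λ.card ≤ 2 ^ s * 2 ^ s := by
      refine (Finset.card_filter_le _ _).trans ?_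
      simp only [Finset.card_product, Finset.card_univ, Fintype.card_fin, Nat.card_Ico,
        Finset.card_range]
      have h3 : 2 ^ (s + 1) - 2 ^ s = 2 ^ s := by omega
      rw [h3]
      calc 2 ^ s * 4 * 2 * (2 ^ (s + 1) / 1000) = 2 ^ s * (8 * (2 ^ (s + 1) / 1000)) := by ring
        _ ≤ _ := Nat.mul_le_mul_left _ (by omega)
    calc (Λ.card : ℝ) ≤ ((2 ^ s * 2 ^ s : ℕ) : ℝ) := by exact_mod_cast h1
      _ = 2 ^ ((2 : ℝ) * s) := by
        rw [mul_comm (2 : ℝ), Real.rpow_mul (by norm_num), Real.rpow_natCast, Real.rpow_two]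
        push_cast; ring
  have hs8 : (2 : ℝ) * s ≤ 2 ^ s / 4 := by
    have : 8 * s ≤ 2 ^ s := by
      clear * - hs
      induction s, hs using Nat.le_induction with
      | base => norm_num
      | succ s hs ih => rw [pow_succ]; omega
    have : (8 * s : ℝ) ≤ 2 ^ s := by exact_mod_cast this
    linarith
  calc _ ≤ ((Λ.biUnion X).card : ℝ) := by exact_mod_cast Finset.card_le_card hsub
    _ ≤ ∑ l ∈ Λ, ((X l).card : ℝ) := by exact_mod_cast Finset.card_biUnion_le
    _ ≤ Λ.card * 2 ^ ((F.card : ℝ) - 2 ^ s / 2) := by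
        rw [← nsmul_eq_mul]; exact Finset.sum_le_card_nsmul _ _ _ hXcard
    _ ≤ 2 ^ ((2 : ℝ) * s) * 2 ^ ((F.card : ℝ) - 2 ^ s / 2) :=
        mul_le_mul_of_nonneg_right hΛcard (by positivity)
    _ ≤ 2 ^ (-((2 : ℝ) ^ s / 4) + F.card) := by
        rw [← Real.rpow_add (by norm_num)]
        exact Real.rpow_le_rpow_of_exponent_le (by norm_num) (by linarith)
    _ = _ := by rw [Real.rpow_add (by norm_num), Real.rpow_natCast]

open Classical in
/-- Events that depend on disjoint blocks are independent. -/
lemma card_forall_le {α ι : Type*} (I : Finset ι) (F : Finset α) (G : ι → Finset α)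
    (E : ι → Finset α → Prop) {δ : ℝ} (hδ : 0 ≤ δ) (hGF : ∀ i ∈ I, G i ⊆ F)
    (hdisj : ∀ i ∈ I, ∀ j ∈ I, i ≠ j → Disjoint (G i) (G j))
    (hE : ∀ i ∈ I, ∀ A A' : Finset α, A ∩ G i = A' ∩ G i → E i A → E i A')
    (hcard : ∀ i ∈ I, (({A ∈ (G i).powerset | E i A}.card : ℕ) : ℝ) ≤ δ * 2 ^ (G i).card) :
    (({A ∈ F.powerset | ∀ i ∈ I, E i A}.card : ℕ) : ℝ) ≤ δ ^ I.card * 2 ^ F.card := by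
  induction I using Finset.induction_on generalizing F with
  | empty => simp
  | insert i I hi ih =>
    have h1 := ih (F \ G i)
      (fun j hj => Finset.subset_sdiff.2 ⟨hGF j (Finset.mem_insert_of_mem hj),
        hdisj j (Finset.mem_insert_of_mem hj) i (Finset.mem_insert_self _ _)
          (by rintro rfl; exact hi hj)⟩)
      (fun j hj k hk => hdisj j (Finset.mem_insert_of_mem hj) k (Finset.mem_insert_of_mem hk))
      (fun j hj => hE j (Finset.mem_insert_of_mem hj))
      (fun j hj => hcard j (Finset.mem_insert_of_mem hj))
    have h2 := hcard i (Finset.mem_insert_self _ _)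
    have hGi := hGF i (Finset.mem_insert_self _ _)
    have h3 : {A ∈ F.powerset | ∀ j ∈ insert i I, E j A}.card ≤
        ({A ∈ (F \ G i).powerset | ∀ j ∈ I, E j A} ×ˢ {A ∈ (G i).powerset | E i A}).card := by
      refine Finset.card_le_card_of_injOn (fun A => (A \ G i, A ∩ G i)) (fun A hA => ?_) ?_
      · obtain ⟨hA1, hA2⟩ := Finset.mem_filter.1 (Finset.mem_coe.1 hA)
        have hAF := Finset.mem_powerset.1 hA1
        refine Finset.mem_coe.2 (Finset.mem_product.2 ⟨Finset.mem_filter.2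
          ⟨Finset.mem_powerset.2 (Finset.sdiff_subset_sdiff hAF le_rfl), fun j hj => ?_⟩,
          Finset.mem_filter.2 ⟨Finset.mem_powerset.2 Finset.inter_subset_right, ?_⟩⟩)
        · refine hE j (Finset.mem_insert_of_mem hj) A _ ?_ (hA2 j (Finset.mem_insert_of_mem hj))
          have hd := hdisj j (Finset.mem_insert_of_mem hj) i (Finset.mem_insert_self _ _)
            (by rintro rfl; exact hi hj)
          ext x
          simp only [Finset.mem_inter, Finset.mem_sdiff]
          constructor
          · rintro ⟨h, h'⟩; exact ⟨⟨h, Finset.disjoint_left.1 hd h'⟩, h'⟩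
          · rintro ⟨⟨h, -⟩, h'⟩; exact ⟨h, h'⟩
        · exact hE i (Finset.mem_insert_self _ _) A _ (by simp)
            (hA2 i (Finset.mem_insert_self _ _))
      · intro A _ B _ hAB
        simp only [Prod.mk.injEq] at hAB
        rw [← Finset.sdiff_union_inter A (G i), ← Finset.sdiff_union_inter B (G i), hAB.1, hAB.2]
    rw [Finset.card_product] at h3
    have h4 : F.card = (F \ G i).card + (G i).card := (Finset.card_sdiff_add_card_eq_card hGi).symm
    rw [Finset.card_insert_of_notMem hi]
    calc _ ≤ (({A ∈ (F \ G i).powerset | ∀ j ∈ I, E j A}.card : ℕ) : ℝ) *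
          (({A ∈ (G i).powerset | E i A}.card : ℕ) : ℝ) := by exact_mod_cast h3
      _ ≤ (δ ^ I.card * 2 ^ (F \ G i).card) * (δ * 2 ^ (G i).card) :=
        mul_le_mul h1 h2 (by positivity) (by positivity)
      _ = _ := by rw [h4]; ring

lemma choose_le_four_mul_div_pow (N M : ℕ) (hM : 1 ≤ M) :
    (N.choose M : ℝ) ≤ (4 * N / M) ^ M := by
  have h1 := Nat.choose_le_pow_div (α := ℝ) M N
  have h2 := Real.pow_div_factorial_le_exp (x := M) (by positivity) M
  have h3 : Real.exp M ≤ 4 ^ M := by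
    rw [← Real.exp_one_pow]
    exact pow_le_pow_left₀ (by positivity) (by linarith [Real.exp_one_lt_d9]) _
  have hM0 : (0 : ℝ) < M := by exact_mod_cast hM
  calc (N.choose M : ℝ) ≤ N ^ M / M.factorial := h1
    _ = (N / M) ^ M * (M ^ M / M.factorial) := by
        rw [div_pow]; field_simp
    _ ≤ (N / M) ^ M * 4 ^ M := by gcongr; exact h2.trans h3
    _ = _ := by rw [← mul_pow]; ring_nf

/-- With `M = N / 8^s + 1` the binomial coefficient is at most `2^((3 s + 2) M)`, which half of the
exponent `2^s / 4` absorbs once `s ≥ 13`. What is left is `M 2^s / 8`, and `N ≤ M 8^s ≤ (M 2^s)^3`.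
-/
lemma scale_union_bound {N s : ℕ} (hs : 13 ≤ s) :
    (N.choose (N / 8 ^ s + 1) : ℝ) * ((2 : ℝ) ^ (-((2 : ℝ) ^ s / 4))) ^ (N / 8 ^ s + 1) ≤
      2 ^ (-((N : ℝ) ^ (1 / 3 : ℝ) / 8)) := by
  set M := N / 8 ^ s + 1 with hM
  have hM1 : 1 ≤ M := Nat.le_add_left 1 _
  have hM0 : (1 : ℝ) ≤ M := by exact_mod_cast hM1
  have hNM : N ≤ M * 8 ^ s := by
    have := Nat.div_add_mod N (8 ^ s)
    have h2 := Nat.mod_lt N (by positivity : 0 < 8 ^ s)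
    rw [hM, add_mul, one_mul, mul_comm]
    omega
  have hNM' : (N : ℝ) ≤ M * 8 ^ s := by exact_mod_cast hNM
  have hs8 : (3 : ℝ) * s + 2 ≤ 2 ^ s / 8 := by
    have : 8 * (3 * s + 2) ≤ 2 ^ s := by
      clear * - hs
      induction s, hs using Nat.le_induction with
      | base => norm_num
      | succ s hs ih => rw [pow_succ]; omega
    have : (8 * (3 * s + 2) : ℝ) ≤ 2 ^ s := by exact_mod_cast this
    linarith
  have h1 : (N.choose M : ℝ) ≤ (2 : ℝ) ^ ((3 * s + 2) * M : ℝ) := by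
    refine (choose_le_four_mul_div_pow N M hM1).trans ?_
    rw [Real.rpow_mul (by norm_num), Real.rpow_natCast]
    refine pow_le_pow_left₀ (by positivity) ?_ _
    have : (2 : ℝ) ^ (3 * s + 2 : ℝ) = 8 ^ s * 4 := by
      rw [Real.rpow_add (by norm_num), Real.rpow_mul (by norm_num), Real.rpow_natCast]
      norm_num
    rw [this, div_le_iff₀ (by linarith)]
    linarith
  have h2 : ((2 : ℝ) ^ (-((2 : ℝ) ^ s / 4))) ^ M = 2 ^ (-((2 : ℝ) ^ s / 4) * M) := by
    rw [Real.rpow_mul (by norm_num), Real.rpow_natCast]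
  have h3 : (N : ℝ) ^ (1 / 3 : ℝ) ≤ M * 2 ^ s := by
    have h4 : (N : ℝ) ≤ (M * 2 ^ s) ^ (3 : ℕ) := by
      have : (8 : ℝ) ^ s = (2 ^ s) ^ 3 := by rw [← pow_mul, mul_comm, pow_mul]; norm_num
      rw [mul_pow, ← this]
      refine hNM'.trans (mul_le_mul_of_nonneg_right ?_ (by positivity))
      nlinarith [sq_nonneg ((M : ℝ) - 1)]
    calc (N : ℝ) ^ (1 / 3 : ℝ) ≤ (((M : ℝ) * 2 ^ s) ^ (3 : ℕ)) ^ (1 / 3 : ℝ) :=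
          Real.rpow_le_rpow (by positivity) h4 (by norm_num)
      _ = M * 2 ^ s := by
          rw [← Real.rpow_natCast, ← Real.rpow_mul (by positivity)]; norm_num
  rw [h2]
  calc _ ≤ (2 : ℝ) ^ ((3 * s + 2) * M : ℝ) * 2 ^ (-((2 : ℝ) ^ s / 4) * M) :=
        mul_le_mul_of_nonneg_right h1 (by positivity)
    _ ≤ _ := by
        rw [← Real.rpow_add (by norm_num)]
        refine Real.rpow_le_rpow_of_exponent_le (by norm_num) ?_
        nlinarith

open Classical in
/-- With overwhelming probability, only few central points fail. -/
theorem card_many_failures_le {η K Vb lam0 : ℝ} {a : ℤ × ℤ} {n : ℕ} {Θ : Set (ℤ × ℤ)}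
    {V' : ℤ × ℤ → ℝ} {F : Finset (ℤ × ℤ)} (hη : 0 ≤ η) (hη' : η ≤ 1 / 10 ^ 8) (hV : 2 ≤ Vb)
    (hlam : lam0 ∈ Set.Icc (0 : ℝ) 8) (hV' : ∀ p ∈ Θ, V' p = 0 ∨ V' p = Vb)
    (hK : 100 * n * (Vb + 8) ≤ K) (hF : ∀ q ∈ cube a n, q ∉ Θ → q ∈ F) :
    (({A ∈ F.powerset | ¬ 4 * {p ∈ cube a (n / 100) |
      Fails η K lam0 Θ (configPotential Θ V' Vb A) (2 ^ 13) (4 * (n / 100)) p}.card ≤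
        (cube a (n / 100)).card}.card : ℕ) : ℝ) ≤
      n * 2 ^ (-(((cube a (n / 100)).card : ℝ) ^ (1 / 3 : ℝ) / 8)) * 2 ^ F.card := by
  set m := n / 100 with hm
  set C := cube a m with hC
  set N := C.card with hN
  set fail : ℕ → Finset (ℤ × ℤ) → ℤ × ℤ → Prop := fun s A p =>
    Fails η K lam0 Θ (configPotential Θ V' Vb A) (2 ^ s) (2 ^ (s + 1)) p with hfail
  set J := {s ∈ Finset.Ico 13 (4 * m) | 2 ^ s < 4 * m} with hJ
  set disj : ℕ → Finset (ℤ × ℤ) → Prop := fun s I => ∀ p ∈ I, ∀ q ∈ I, p ≠ q →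
    Disjoint (tball p (2 * 2 ^ (s + 1))) (tball q (2 * 2 ^ (s + 1))) with hdisj
  -- The exceptional event at scale `s`: more than `N / 8^s` centres fail with pairwise disjoint
  -- balls.
  set bad : ℕ → Finset (Finset (ℤ × ℤ)) := fun s =>
    {I ∈ C.powersetCard (N / 8 ^ s + 1) | disj s I}.biUnion fun I =>
      {A ∈ F.powerset | ∀ p ∈ I, fail s A p} with hbad
  have hTsub : ∀ s ∈ J, ∀ p ∈ C, tball p (2 * 2 ^ (s + 1)) ⊆ cube a n := by
    intro s hs p hp
    have := (Finset.mem_filter.1 hs).2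
    refine tball_subset_cube hp ?_
    rw [pow_succ]; omega
  have hbadcard : ∀ s ∈ J, ((bad s).card : ℝ) ≤
      2 ^ (-((N : ℝ) ^ (1 / 3 : ℝ) / 8)) * 2 ^ F.card := by
    intro s hs
    obtain ⟨hs1, hs2⟩ := Finset.mem_filter.1 hs
    have hs3 := (Finset.mem_Ico.1 hs1).1
    set δ : ℝ := 2 ^ (-((2 : ℝ) ^ s / 4)) with hδ
    have hone : ∀ I ∈ {I ∈ C.powersetCard (N / 8 ^ s + 1) | disj s I},
        (({A ∈ F.powerset | ∀ p ∈ I, fail s A p}.card : ℕ) : ℝ) ≤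
          δ ^ (N / 8 ^ s + 1) * 2 ^ F.card := by
      intro I hI
      obtain ⟨hI1, hI2⟩ := Finset.mem_filter.1 hI
      obtain ⟨hIC, hIcard⟩ := Finset.mem_powersetCard.1 hI1
      rw [← hIcard]
      have hFp : ∀ p ∈ I, ∀ q ∈ tball p (2 * 2 ^ (s + 1)), q ∉ Θ →
          q ∈ F ∩ tball p (2 * 2 ^ (s + 1)) := fun p hp q hq hqΘ =>
        Finset.mem_inter.2 ⟨hF q (hTsub s hs p (hIC hp) hq) hqΘ, hq⟩
      refine card_forall_le I F (fun p => F ∩ tball p (2 * 2 ^ (s + 1)))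
        (fun p A => fail s A p) (by positivity)
        (fun p _ => Finset.inter_subset_left)
        (fun p hp q hq hpq => (hI2 p hp q hq hpq).mono Finset.inter_subset_right
          Finset.inter_subset_right) (fun p hp A A' hAA hA => ?_) (fun p hp => ?_)
      · refine Fails.congr ?_ hA fun q hq => ?_
        · exact le_trans (by norm_num) (Nat.pow_le_pow_right (by norm_num) hs3)
        · unfold configPotential
          by_cases hqΘ : q ∈ Θ
          · rw [if_pos hqΘ, if_pos hqΘ]
          · have := Finset.ext_iff.1 hAA q
            simp only [Finset.mem_inter, Finset.mem_inter.1 (hFp p hp q hq hqΘ), and_self,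
              and_true] at this
            simp only [if_neg hqΘ, this]
      · exact card_fails_le hη hη' hV hlam hV' hK hs3 (by omega) (hFp p hp)
    calc ((bad s).card : ℝ) ≤ ∑ I ∈ {I ∈ C.powersetCard (N / 8 ^ s + 1) | disj s I},
          (({A ∈ F.powerset | ∀ p ∈ I, fail s A p}.card : ℕ) : ℝ) := by
          exact_mod_cast Finset.card_biUnion_le
      _ ≤ _ := Finset.sum_le_card_nsmul _ _ _ hone
      _ ≤ (N.choose (N / 8 ^ s + 1) : ℝ) * (δ ^ (N / 8 ^ s + 1) * 2 ^ F.card) := by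
          rw [nsmul_eq_mul]
          refine mul_le_mul_of_nonneg_right ?_ (by positivity)
          have := (Finset.card_filter_le (C.powersetCard (N / 8 ^ s + 1)) (disj s))
          rw [Finset.card_powersetCard] at this
          exact_mod_cast this
      _ ≤ _ := by
          rw [← mul_assoc]
          exact mul_le_mul_of_nonneg_right (scale_union_bound hs3) (by positivity)
  have hsub : {A ∈ F.powerset | ¬ 4 * {p ∈ C |
      Fails η K lam0 Θ (configPotential Θ V' Vb A) (2 ^ 13) (4 * m) p}.card ≤ N} ⊆
      J.biUnion bad := by
    intro A hA
    obtain ⟨hAF, hA⟩ := Finset.mem_filter.1 hA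
    by_contra hnot
    apply hA
    have hgood : ∀ s ∈ J, ∀ I ⊆ C, disj s I → (∀ p ∈ I, fail s A p) → I.card ≤ N / 8 ^ s := by
      intro s hs I hIC hI hIf
      by_contra! hlt
      obtain ⟨I', hI', hcard⟩ := Finset.exists_subset_card_eq (Nat.succ_le_of_lt hlt)
      refine hnot (Finset.mem_biUnion.2 ⟨s, hs, Finset.mem_biUnion.2 ⟨I', Finset.mem_filter.2
        ⟨Finset.mem_powersetCard.2 ⟨hI'.trans hIC, hcard⟩, fun p hp q hq => hI p (hI' hp) q (hI' hq)⟩,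
        Finset.mem_filter.2 ⟨hAF, fun p hp => hIf p (hI' hp)⟩⟩⟩)
    -- Outside the exceptional events, the covering lemma turns the bound on disjoint failures into
    -- one on all failures: `169 * (N / 8^s) * (2^(s+1))^2`, and `676 = 169 * 4`.
    have hscale : ∀ s ∈ J, (({p ∈ C | fail s A p}.card : ℕ) : ℝ) ≤ 676 * N * (1 / 2) ^ s := by
      intro s hs
      obtain ⟨I, hI, hId, hIcard⟩ := exists_disjoint_tballs {p ∈ C | fail s A p}
        (fun _ => 2 ^ (s + 1)) (fun _ _ => Nat.one_le_two_pow)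
      have h1 := hgood s hs I (hI.trans (Finset.filter_subset _ _)) hId
        fun p hp => (Finset.mem_filter.1 (hI hp)).2
      have h2 : (I.card : ℝ) ≤ N / 8 ^ s := by
        have : ((N / 8 ^ s : ℕ) : ℝ) ≤ N / ((8 ^ s : ℕ) : ℝ) := Nat.cast_div_le
        push_cast at this
        exact le_trans (by exact_mod_cast h1) this
      have h3 : (({p ∈ C | fail s A p}.card : ℕ) : ℝ) ≤ 169 * (I.card * (2 ^ (s + 1)) ^ 2) := by
        rw [Finset.sum_const, smul_eq_mul] at hIcard
        exact_mod_cast hIcard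
      have h8 : (8 : ℝ) ^ s = 2 ^ s * (2 ^ s) ^ 2 := by
        rw [← pow_succ', ← pow_mul, mul_comm, pow_mul]; norm_num
      calc _ ≤ _ := h3
        _ ≤ 169 * (N / 8 ^ s * (2 ^ (s + 1)) ^ 2) := by gcongr
        _ = _ := by
          rw [h8, pow_succ, one_div, inv_pow]; field_simp; ring
    have hcover : {p ∈ C | Fails η K lam0 Θ (configPotential Θ V' Vb A) (2 ^ 13) (4 * m) p} ⊆
        J.biUnion fun s => {p ∈ C | fail s A p} := by
      intro p hp
      obtain ⟨hpC, r, hr1, hr2, hr3⟩ := Finset.mem_filter.1 hp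
      have hr0 : r ≠ 0 := by have : 0 < 2 ^ 13 := by norm_num
                             omega
      have hl1 : 2 ^ Nat.log 2 r ≤ r := Nat.pow_log_le_self 2 hr0
      have hl2 : r < 2 ^ (Nat.log 2 r + 1) := Nat.lt_pow_succ_log_self one_lt_two r
      have hl3 : 13 ≤ Nat.log 2 r := Nat.le_log_of_pow_le one_lt_two hr1
      have hl4 : Nat.log 2 r < 2 ^ Nat.log 2 r := Nat.lt_two_pow_self
      refine Finset.mem_biUnion.2 ⟨Nat.log 2 r, Finset.mem_filter.2
        ⟨Finset.mem_Ico.2 ⟨hl3, by omega⟩, by omega⟩, Finset.mem_filter.2 ⟨hpC, ?_⟩⟩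
      exact ⟨r, hl1, hl2, hr3⟩
    have hR : (({p ∈ C | Fails η K lam0 Θ (configPotential Θ V' Vb A) (2 ^ 13) (4 * m) p}.card : ℕ)
        : ℝ) ≤ 676 * N * (1 / 4096) := by
      calc _ ≤ ((J.biUnion fun s => {p ∈ C | fail s A p}).card : ℝ) := by
            exact_mod_cast Finset.card_le_card hcover
        _ ≤ ∑ s ∈ J, (({p ∈ C | fail s A p}.card : ℕ) : ℝ) := by
            exact_mod_cast Finset.card_biUnion_le
        _ ≤ ∑ s ∈ J, 676 * N * (1 / 2 : ℝ) ^ s := Finset.sum_le_sum hscale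
        _ ≤ ∑ s ∈ Finset.Ico 13 (4 * m), 676 * N * (1 / 2 : ℝ) ^ s :=
            Finset.sum_le_sum_of_subset_of_nonneg (Finset.filter_subset _ _)
              fun _ _ _ => by positivity
        -- The geometric tail starting at `s = 13` is at most `2^(-12)`, and `676 / 4096 < 1 / 4`;
        -- this decides the starting scale `2^13`.
        _ ≤ 676 * N * (1 / 4096) := by
            rw [← Finset.mul_sum]
            refine mul_le_mul_of_nonneg_left ?_ (by positivity)
            refine (geom_sum_Ico_le_of_lt_one (by norm_num) (by norm_num)).trans ?_
            norm_num
    have : ((4 * {p ∈ C | Fails η K lam0 Θ (configPotential Θ V' Vb A) (2 ^ 13)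
        (4 * m) p}.card : ℕ) : ℝ) ≤ (N : ℝ) := by
      push_cast
      have : (0 : ℝ) ≤ N := by positivity
      linarith
    exact_mod_cast this
  have hJcard : J.card ≤ n := by
    refine (Finset.card_filter_le _ _).trans ?_
    rw [Nat.card_Ico]; omega
  calc _ ≤ ((J.biUnion bad).card : ℝ) := by exact_mod_cast Finset.card_le_card hsub
    _ ≤ ∑ s ∈ J, ((bad s).card : ℝ) := by exact_mod_cast Finset.card_biUnion_le
    _ ≤ J.card * (2 ^ (-((N : ℝ) ^ (1 / 3 : ℝ) / 8)) * 2 ^ F.card) := by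
        rw [← nsmul_eq_mul]; exact Finset.sum_le_card_nsmul _ _ _ hbadcard
    _ ≤ n * (2 ^ (-((N : ℝ) ^ (1 / 3 : ℝ) / 8)) * 2 ^ F.card) :=
        mul_le_mul_of_nonneg_right (by exact_mod_cast hJcard) (by positivity)
    _ = _ := by ring

/-! ### Unique continuation for configurations -/

lemma box_eq_cube (a : ℤ × ℤ) {l : ℝ} {n : ℕ} (hn : ⌊(l - 1) / 2⌋ = n) :
    box a l = (cube a n : Set (ℤ × ℤ)) := by
  ext q
  have h : ∀ z : ℤ, (‖z‖ ≤ (l - 1) / 2) ↔ |z| ≤ n := by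
    intro z
    rw [← hn, Int.le_floor, Int.norm_eq_abs, Int.cast_abs]
  simp only [box, Set.mem_ofPred_eq, Prod.norm_def, max_le_iff, Prod.fst_sub, Prod.snd_sub, h,
    Finset.mem_coe, mem_cube]

lemma box_subset_cube (a : ℤ × ℤ) {l : ℝ} {n : ℕ} (hn : ⌊(l - 1) / 2⌋ = n) :
    box a (l / 100) ⊆ (cube a (n / 100) : Set (ℤ × ℤ)) := by
  intro q hq
  have hl : (l - 1) / 2 < n + 1 := by
    have := Int.lt_floor_add_one ((l - 1) / 2)
    rw [hn] at this
    exact_mod_cast this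
  have h : ∀ z : ℤ, ‖z‖ ≤ (l / 100 - 1) / 2 → |z| ≤ (n / 100 : ℕ) := by
    intro z hz
    rw [Int.norm_eq_abs, ← Int.cast_abs] at hz
    have h1 : (100 * |z| : ℝ) < n + 1 := by linarith
    have h2 : 100 * |z| < (n : ℤ) + 1 := by exact_mod_cast h1
    push_cast
    omega
  simp only [box, Set.mem_ofPred_eq, Prod.norm_def, max_le_iff, Prod.fst_sub, Prod.snd_sub] at hq
  exact Finset.mem_coe.2 (mem_cube.2 ⟨h _ hq.1, h _ hq.2⟩)

lemma sideLength_eq {l : ℝ} {n : ℕ} (hn : ⌊(l - 1) / 2⌋ = n) : sideLength l = 2 * n := by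
  rw [sideLength, hn]; simp

open Classical in
/-- If few central points fail, then the unique continuation property holds. -/
lemma frozenUniqueContinuation_of_few_failures {ε α Vb lam0 l : ℝ} {V : ℤ × ℤ → ℝ} {a : ℤ × ℤ}
    {n : ℕ} {Θ : Finset (ℤ × ℤ)} (hn : ⌊(l - 1) / 2⌋ = n) (hn' : 10 ^ 6 ≤ n) (hε : 0 < ε)
    (hε' : ε ≤ 1 / 10 ^ 20) (hV : 2 ≤ Vb) (hα : 2 ≤ α) (hΘ : Θ ⊆ cube a n)
    (hreg : IsRegularIn ε Θ (cube a n : Set (ℤ × ℤ)))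
    (hfail : 4 * {p ∈ cube a (n / 100) |
      Fails ε ((2 * n * Vb) ^ 2) lam0 Θ V (2 ^ 13) (4 * (n / 100)) p}.card ≤
        (cube a (n / 100)).card) :
    FrozenUniqueContinuation ε α Vb lam0 a l Θ V := by
  intro lam u hlam hsol hgood b hb
  have hnR : (10 ^ 6 : ℝ) ≤ n := by exact_mod_cast hn'
  have hb1 : 1 ≤ 2 * n * Vb := by nlinarith
  have hb0 : 0 < 2 * n * Vb := by linarith
  rw [sideLength_eq hn] at hlam ⊢
  rw [box_eq_cube a hn] at hsol hgood
  -- With `K = (L Vb)^2` and `L = 2 n`, the power `K^n` is `(L Vb)^L`, so any `α ≥ 2` covers both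
  -- the energy window `K^(-n)` and the bound `K^(2 n)`.
  have hpow : ((2 * n * Vb) ^ 2) ^ n = (2 * n * Vb) ^ ((2 : ℝ) * n) := by
    rw [← pow_mul, ← Real.rpow_natCast]; push_cast; rfl
  have hlam' : |lam - lam0| ≤ (((2 * n * Vb) ^ 2) ^ n)⁻¹ := by
    rw [hpow, ← Real.rpow_neg hb0.le]
    refine hlam.trans (Real.rpow_le_rpow_of_exponent_le hb1 ?_)
    nlinarith
  set Q := cube a n with hQ
  have hbad : (({q ∈ Q | q ∉ Θ ∧ 1 < |u q|}.card : ℕ) : ℝ) ≤ ε * Q.card := by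
    have e1 : ((Q : Set (ℤ × ℤ)) \ Θ).ncard = (Q \ Θ).card := by
      rw [← Finset.coe_sdiff, Set.ncard_coe_finset]
    have e2 : {b ∈ (Q : Set (ℤ × ℤ)) \ Θ | |u b| ≤ 1}.ncard = {q ∈ Q \ Θ | |u q| ≤ 1}.card := by
      rw [← Set.ncard_coe_finset]
      congr 1
      ext q; simp
    rw [e1, e2] at hgood
    have e3 := Finset.card_filter_add_card_filter_not (s := Q \ Θ) (fun q => |u q| ≤ 1)
    have e4 : {q ∈ Q | q ∉ Θ ∧ 1 < |u q|} = {q ∈ Q \ Θ | ¬ |u q| ≤ 1} := by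
      ext q; simp [and_assoc]
    rw [e4]
    have e5 : (({q ∈ Q \ Θ | |u q| ≤ 1}.card : ℕ) : ℝ) +
        (({q ∈ Q \ Θ | ¬ |u q| ≤ 1}.card : ℕ) : ℝ) = (Q \ Θ).card := by exact_mod_cast e3
    have e6 : ((Q \ Θ).card : ℝ) ≤ Q.card := by
      exact_mod_cast Finset.card_le_card Finset.sdiff_subset
    have e7 : ε ^ 3 ≤ ε := by
      calc ε ^ 3 ≤ ε ^ 1 := pow_le_pow_of_le_one hε.le (hε'.trans (by norm_num)) (by norm_num)
        _ = ε := pow_one ε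
    calc _ ≤ ε ^ 3 * ((Q \ Θ).card : ℝ) := by linarith
      _ ≤ ε * Q.card := mul_le_mul e7 e6 (by positivity) hε.le
  have := bound_of_few_failures hε.le hε' (one_le_pow₀ hb1) (by norm_num) (by norm_num)
    (by omega) hΘ hreg hsol hlam' hbad hfail b (Finset.mem_coe.1 (box_subset_cube a hn hb))
  refine this.trans ?_
  rw [mul_comm 2 n, pow_mul, hpow, ← Real.rpow_natCast, ← Real.rpow_mul hb0.le]
  refine Real.rpow_le_rpow_of_exponent_le hb1 ?_
  push_cast
  nlinarith

lemma FrozenUniqueContinuation.congr {ε α Vb lam0 l : ℝ} {V W : ℤ × ℤ → ℝ} {a : ℤ × ℤ}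
    {Θ : Set (ℤ × ℤ)} (h : FrozenUniqueContinuation ε α Vb lam0 a l Θ V)
    (hVW : ∀ b ∈ box a l, W b = V b) : FrozenUniqueContinuation ε α Vb lam0 a l Θ W := by
  intro lam u hlam hsol
  refine h lam u hlam fun b hb => ?_
  rw [← hsol b hb, hamiltonian, hamiltonian, hVW b hb]

/-! ### Transfer to the probability space -/

lemma IsBernoulliPotential.ae_mem {Ω : Type*} [MeasurableSpace Ω] {P : Measure Ω}
    [IsProbabilityMeasure P] {Vb : ℝ} (hV : 2 ≤ Vb) {V : ℤ × ℤ → Ω → ℝ}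
    (h : IsBernoulliPotential P Vb V) (b : ℤ × ℤ) : P {ω | ¬ (V b ω = 0 ∨ V b ω = Vb)} = 0 := by
  have hm : ∀ c, MeasurableSet {ω | V b ω = c} := fun c =>
    h.measurable b (measurableSet_singleton c)
  have h1 : P ({ω | V b ω = 0} ∪ {ω | V b ω = Vb}) = 1 := by
    rw [measure_union _ (hm _), h.prob_zero, h.prob_Vbar, ENNReal.add_halves]
    rw [Set.disjoint_left]
    intro ω h0 h1
    have h0' : V b ω = 0 := h0
    have h1' : V b ω = Vb := h1
    linarith
  have h2 := (prob_compl_eq_zero_iff ((hm 0).union (hm Vb))).2 h1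
  exact h2

lemma IsBernoulliPotential.measure_cylinder {Ω : Type*} [MeasurableSpace Ω] {P : Measure Ω}
    [IsProbabilityMeasure P] {Vb : ℝ} {V : ℤ × ℤ → Ω → ℝ} (h : IsBernoulliPotential P Vb V)
    (S : Finset (ℤ × ℤ)) (v : ℤ × ℤ → ℝ) (hv : ∀ b ∈ S, v b = 0 ∨ v b = Vb) :
    P {ω | ∀ b ∈ S, V b ω = v b} = (1 / 2) ^ S.card := by
  have h1 := h.indep.measure_inter_preimage_eq_mul (S := S) (sets := fun b => {v b})
    (fun b _ => measurableSet_singleton _)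
  have e : {ω | ∀ b ∈ S, V b ω = v b} = ⋂ b ∈ S, V b ⁻¹' {v b} := by ext ω; simp
  rw [e, h1, Finset.prod_congr rfl (g := fun _ => (1 / 2 : ENNReal)), Finset.prod_const]
  intro b hb
  rcases hv b hb with h0 | h0 <;> rw [h0]
  · exact h.prob_zero b
  · exact h.prob_Vbar b

open Classical in
/-- A bound on the number of bad configurations bounds the conditional probability of the bad
event. -/
lemma IsBernoulliPotential.one_sub_le_cond {Ω : Type*} [MeasurableSpace Ω] {P : Measure Ω}
    [IsProbabilityMeasure P] {Vb δ : ℝ} (hV : 2 ≤ Vb) {V : ℤ × ℤ → Ω → ℝ}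
    (h : IsBernoulliPotential P Vb V) {Q Θ : Finset (ℤ × ℤ)} (hΘ : Θ ⊆ Q) {V' : ℤ × ℤ → ℝ}
    (hV' : ∀ b ∈ Θ, V' b = 0 ∨ V' b = Vb) (X : (ℤ × ℤ → ℝ) → Prop)
    (hX : ∀ v w : ℤ × ℤ → ℝ, (∀ b ∈ Q, w b = v b) → X v → X w)
    (hcount : (({A ∈ (Q \ Θ).powerset | ¬ X (configPotential Θ V' Vb A)}.card : ℕ) : ℝ) ≤
      δ * 2 ^ (Q \ Θ).card) :
    1 - δ ≤ (ProbabilityTheory.cond P {ω | ∀ b ∈ (Θ : Set (ℤ × ℤ)), V b ω = V' b}).real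
      {ω | X fun b => V b ω} := by
  set s := {ω | ∀ b ∈ (Θ : Set (ℤ × ℤ)), V b ω = V' b} with hs
  set T := {ω | X fun b => V b ω} with hT
  set Bad := {A ∈ (Q \ Θ).powerset | ¬ X (configPotential Θ V' Vb A)} with hBad
  have hPs : P s = (1 / 2) ^ Θ.card := h.measure_cylinder Θ V' hV'
  have hsm : MeasurableSet s := by
    have e : s = ⋂ b ∈ Θ, V b ⁻¹' {V' b} := by ext ω; simp [hs]
    rw [e]
    exact Finset.measurableSet_biInter _ fun b _ => h.measurable b (measurableSet_singleton _)
  have hPs0 : P s ≠ 0 := by rw [hPs]; exact pow_ne_zero _ (by simp)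
  have := cond_isProbabilityMeasure hPs0
  have hcov : s ∩ Tᶜ ⊆ (⋃ b ∈ Q, {ω | ¬ (V b ω = 0 ∨ V b ω = Vb)}) ∪
      ⋃ A ∈ Bad, {ω | ∀ b ∈ Q, V b ω = configPotential Θ V' Vb A b} := by
    rintro ω ⟨hω, hωT⟩
    by_cases hval : ∀ b ∈ Q, V b ω = 0 ∨ V b ω = Vb
    · right
      have hA : ∀ b ∈ Q, V b ω =
          configPotential Θ V' Vb {b ∈ Q \ Θ | V b ω = Vb} b := by
        intro b hb
        unfold configPotential
        by_cases hbΘ : b ∈ Θ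
        · rw [if_pos (Finset.mem_coe.2 hbΘ)]; exact hω b hbΘ
        · rw [if_neg (by simpa using hbΘ)]
          by_cases hbV : V b ω = Vb
          · rw [if_pos (by simp [hb, hbΘ, hbV]), hbV]
          · rw [if_neg (by simp [hbV])]
            exact (hval b hb).resolve_right hbV
      refine Set.mem_biUnion (x := {b ∈ Q \ Θ | V b ω = Vb}) ?_ hA
      refine Finset.mem_coe.2 (Finset.mem_filter.2
        ⟨Finset.mem_powerset.2 (Finset.filter_subset _ _), fun hXA => hωT ?_⟩)
      exact hX _ _ hA hXA
    · left
      push Not at hval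
      obtain ⟨b, hb, hb'⟩ := hval
      exact Set.mem_biUnion (Finset.mem_coe.2 hb) (not_or.2 hb')
  have hnull : P (⋃ b ∈ Q, {ω | ¬ (V b ω = 0 ∨ V b ω = Vb)}) = 0 :=
    (measure_biUnion_null_iff Q.countable_toSet).2 fun b _ => h.ae_mem hV b
  have hbadP : P (⋃ A ∈ Bad, {ω | ∀ b ∈ Q, V b ω = configPotential Θ V' Vb A b}) ≤
      Bad.card * (1 / 2) ^ Q.card := by
    refine (measure_biUnion_finset_le _ _).trans ?_
    rw [← nsmul_eq_mul, ← Finset.sum_const]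
    refine Finset.sum_le_sum fun A _ => le_of_eq (h.measure_cylinder Q _ fun b _ => ?_)
    exact configPotential_eq (Θ := (Θ : Set (ℤ × ℤ))) hV' A b
  have hPsT : P (s ∩ Tᶜ) ≤ Bad.card * (1 / 2) ^ Q.card := by
    refine (measure_mono hcov).trans ((measure_union_le _ _).trans ?_)
    rw [hnull, zero_add]
    exact hbadP
  have hcard : Q.card = Θ.card + (Q \ Θ).card := by
    rw [add_comm]; exact (Finset.card_sdiff_add_card_eq_card hΘ).symm
  have hδ : (ProbabilityTheory.cond P s).real Tᶜ ≤ δ := by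
    rw [Measure.real, cond_apply hsm, hPs, ENNReal.toReal_mul]
    have h1 : (P (s ∩ Tᶜ)).toReal ≤ Bad.card * (1 / 2) ^ Q.card := by
      refine (ENNReal.toReal_mono (ENNReal.mul_ne_top (by simp) (by simp)) hPsT).trans (le_of_eq ?_)
      simp
    have h2 : (((1 / 2 : ENNReal) ^ Θ.card)⁻¹).toReal = 2 ^ Θ.card := by simp
    rw [h2]
    calc _ ≤ (2 : ℝ) ^ Θ.card * (Bad.card * (1 / 2) ^ Q.card) :=
          mul_le_mul_of_nonneg_left h1 (by positivity)
      _ ≤ 2 ^ Θ.card * ((δ * 2 ^ (Q \ Θ).card) * (1 / 2) ^ Q.card) := by gcongr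
      _ = δ := by
        rw [hcard, pow_add, one_div, inv_pow, inv_pow]; field_simp
  -- Measurability of `T` is not available, so subadditivity on `T ∪ Tᶜ` replaces the complement
  -- rule.
  have h1 : (1 : ℝ) ≤ (ProbabilityTheory.cond P s).real T +
      (ProbabilityTheory.cond P s).real Tᶜ := by
    rw [← probReal_univ (μ := ProbabilityTheory.cond P s), ← Set.union_compl_self T]
    exact measureReal_union_le _ _
  linarith

/-! ### The main theorem -/

/-- The central cube has at least `(n / 100)^2` points, so the failure exponent is a constant times
`n^(2/3)`. This absorbs the factor `n` and leaves far more than `ε ≤ 10^(-20)` asks for, so one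
threshold serves all `ε`. -/
lemma exists_scale_threshold : ∃ n₀ : ℕ, 10 ^ 6 ≤ n₀ ∧ ∀ n : ℕ, n₀ ≤ n → ∀ ε : ℝ, 0 < ε →
    ε ≤ 1 / 10 ^ 20 → ∀ a : ℤ × ℤ,
    n * (2 : ℝ) ^ (-(((cube a (n / 100)).card : ℝ) ^ (1 / 3 : ℝ) / 8)) ≤
      Real.exp (-(ε * (2 * n : ℝ) ^ (2 / 3 : ℝ))) := by
  have h := (isLittleO_log_rpow_atTop (show (0 : ℝ) < 2 / 3 by norm_num)).bound
    (show (0 : ℝ) < 1 / 3200 by norm_num)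
  obtain ⟨x₀, hx₀⟩ := Filter.eventually_atTop.1 h
  refine ⟨max (10 ^ 6) ⌈x₀⌉₊, le_max_left _ _, fun n hn ε hε hε' a => ?_⟩
  have hn6 : 10 ^ 6 ≤ n := (le_max_left _ _).trans hn
  have hnx : x₀ ≤ n := (Nat.le_ceil x₀).trans (by exact_mod_cast (le_max_right _ _).trans hn)
  have hnR : (10 ^ 6 : ℝ) ≤ n := by exact_mod_cast hn6
  have hn0 : (0 : ℝ) < n := by linarith
  set y : ℝ := (n : ℝ) ^ (2 / 3 : ℝ) with hy
  have hy0 : 0 < y := by positivity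
  have hlog : Real.log n ≤ 1 / 3200 * y := by
    have := hx₀ n hnx
    rw [Real.norm_of_nonneg (Real.log_nonneg (by linarith)), Real.norm_of_nonneg hy0.le] at this
    exact this
  have hx : y / 100 ≤ ((cube a (n / 100)).card : ℝ) ^ (1 / 3 : ℝ) := by
    have h1 : ((n : ℝ) / 100) ^ (2 : ℕ) ≤ (cube a (n / 100)).card := by
      rw [card_cube]
      push_cast
      refine pow_le_pow_left₀ (by positivity) ?_ 2
      have : n ≤ 100 * (2 * (n / 100) + 1) := by omega
      have : (n : ℝ) ≤ 100 * (2 * (n / 100 : ℕ) + 1) := by exact_mod_cast this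
      linarith
    calc y / 100 ≤ y / 100 ^ (2 / 3 : ℝ) := by
          refine div_le_div_of_nonneg_left hy0.le (by positivity) ?_
          calc (100 : ℝ) ^ (2 / 3 : ℝ) ≤ 100 ^ (1 : ℝ) :=
                Real.rpow_le_rpow_of_exponent_le (by norm_num) (by norm_num)
            _ = 100 := Real.rpow_one _
      _ = (((n : ℝ) / 100) ^ (2 : ℕ)) ^ (1 / 3 : ℝ) := by
          rw [← Real.rpow_natCast, ← Real.rpow_mul (by positivity), Real.div_rpow hn0.le (by norm_num)]
          norm_num [hy]
      _ ≤ _ := Real.rpow_le_rpow (by positivity) h1 (by norm_num)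
  have h2n : (2 * n : ℝ) ^ (2 / 3 : ℝ) ≤ 2 * y := by
    rw [Real.mul_rpow (by norm_num) hn0.le]
    refine mul_le_mul_of_nonneg_right ?_ hy0.le
    calc (2 : ℝ) ^ (2 / 3 : ℝ) ≤ 2 ^ (1 : ℝ) :=
          Real.rpow_le_rpow_of_exponent_le (by norm_num) (by norm_num)
      _ = 2 := Real.rpow_one _
  have hε2 : ε * (2 * n : ℝ) ^ (2 / 3 : ℝ) ≤ 1 / 10 ^ 20 * (2 * y) :=
    mul_le_mul hε' h2n (by positivity) (by norm_num)
  calc _ ≤ Real.exp (Real.log n) * Real.exp (-(y / 1600)) := by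
        rw [Real.exp_log hn0]
        refine mul_le_mul_of_nonneg_left ?_ hn0.le
        rw [Real.rpow_def_of_pos (by norm_num), Real.exp_le_exp]
        have hl2 : 1 / 2 ≤ Real.log 2 := by linarith [Real.log_two_gt_d9]
        nlinarith
    _ ≤ _ := by
        rw [← Real.exp_add, Real.exp_le_exp]
        linarith

/-- Unique continuation with a frozen set. -/
theorem exists_frozen_unique_continuation : ∃ α₀ : ℝ, 2 ≤ α₀ ∧ ∀ ε : ℝ, 0 < ε →
    ε ≤ 1 / 10 ^ 20 → ∀ α : ℝ, α₀ ≤ α →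
      ∀ (a : ℤ × ℤ) (l : ℝ) (_ : 1 ≤ l) (_ : α ≤ sideLength l)
        (Θ : Set (ℤ × ℤ)) (_ : Θ ⊆ box a l) (_ : IsRegularIn ε Θ (box a l))
        (Vbar : ℝ) (_ : 2 ≤ Vbar) (lam0 : ℝ) (_ : lam0 ∈ Set.Icc (0 : ℝ) 8)
        (V' : ℤ × ℤ → ℝ) (_ : ∀ b ∈ Θ, V' b = 0 ∨ V' b = Vbar)
        (Ω : Type*) [MeasurableSpace Ω] (P : Measure Ω) [IsProbabilityMeasure P]
        (V : ℤ × ℤ → Ω → ℝ) (_ : IsBernoulliPotential P Vbar V),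
        1 - Real.exp (-(ε * sideLength l ^ (2 / 3 : ℝ))) ≤
          (ProbabilityTheory.cond P {ω | ∀ b ∈ Θ, V b ω = V' b}).real
            {ω | FrozenUniqueContinuation ε α Vbar lam0 a l Θ (fun b => V b ω)} := by
  classical
  obtain ⟨n₀, hn₀, hscale⟩ := exists_scale_threshold
  have hn₀R : (10 ^ 6 : ℝ) ≤ n₀ := by exact_mod_cast hn₀
  -- As `α` also bounds the side length `2 n` from below, this choice forces `n ≥ n₀`.
  refine ⟨2 * n₀, by linarith, fun ε hε hε' α hα a l hl hαl Θ hΘ hreg Vb hV lam0 hlam V' hV' Ω _ P _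
    V hBV => ?_⟩
  obtain ⟨n, hn⟩ : ∃ n : ℕ, ⌊(l - 1) / 2⌋ = n :=
    Int.eq_ofNat_of_zero_le (Int.floor_nonneg.2 (by linarith))
  rw [sideLength_eq hn] at hαl ⊢
  have hnn₀ : n₀ ≤ n := by
    have : (n₀ : ℝ) ≤ n := by linarith
    exact_mod_cast this
  have hnR : (10 ^ 6 : ℝ) ≤ n := hn₀R.trans (by exact_mod_cast hnn₀)
  rw [box_eq_cube a hn] at hΘ hreg
  lift Θ to Finset (ℤ × ℤ) using (cube a n).finite_toSet.subset hΘ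
  have hΘ' : Θ ⊆ cube a n := by exact_mod_cast hΘ
  refine hBV.one_sub_le_cond hV hΘ' hV' (FrozenUniqueContinuation ε α Vb lam0 a l Θ)
    (fun v w hvw h => h.congr (by rw [box_eq_cube a hn]; exact hvw)) ?_
  have hK : 100 * n * (Vb + 8) ≤ (2 * n * Vb) ^ 2 := by
    have h1 : Vb + 8 ≤ 5 * Vb := by linarith
    have h2 : 500 ≤ 4 * n * Vb := by nlinarith
    calc 100 * n * (Vb + 8) ≤ 100 * n * (5 * Vb) := by gcongr
      _ = 500 * (n * Vb) := by ring
      _ ≤ 4 * n * Vb * (n * Vb) := by gcongr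
      _ = _ := by ring
  have hfew := card_many_failures_le (η := ε) (a := a) (n := n) (Θ := (Θ : Set (ℤ × ℤ)))
    (F := cube a n \ Θ) hε.le (hε'.trans (by norm_num)) hV hlam hV' hK
    (fun q hq hqΘ => Finset.mem_sdiff.2 ⟨hq, by simpa using hqΘ⟩)
  refine le_trans ?_ (hfew.trans (mul_le_mul_of_nonneg_right (hscale n hnn₀ ε hε hε' a)
    (by positivity)))
  have hsub : {A ∈ (cube a n \ Θ).powerset |
      ¬ FrozenUniqueContinuation ε α Vb lam0 a l Θ (configPotential Θ V' Vb A)} ⊆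
      {A ∈ (cube a n \ Θ).powerset | ¬ 4 * {p ∈ cube a (n / 100) |
        Fails ε ((2 * n * Vb) ^ 2) lam0 Θ (configPotential Θ V' Vb A) (2 ^ 13)
          (4 * (n / 100)) p}.card ≤ (cube a (n / 100)).card} := by
    intro A hA
    obtain ⟨hA1, hA2⟩ := Finset.mem_filter.1 hA
    exact Finset.mem_filter.2 ⟨hA1, fun h => hA2 (frozenUniqueContinuation_of_few_failures hn
      (hn₀.trans hnn₀) hε hε' hV (by linarith) hΘ' hreg h)⟩
  exact_mod_cast Finset.card_le_card hsub

lemma isRegularIn_empty {η : ℝ} (hη : 0 ≤ η) (E : Set (ℤ × ℤ)) : IsRegularIn η ∅ E := by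
  intro n R _ _ _ hns
  rcases Nat.eq_zero_or_pos n with rfl | hn
  · simp only [Finset.univ_eq_empty, Finset.sum_empty]; positivity
  · refine absurd ⟨fun k => ?_, fun k => ?_⟩ (hns ⟨0, hn⟩) <;>
    · simp only [Set.inter_empty, Set.empty_inter, Set.ncard_empty, Nat.cast_zero]
      positivity

/-- The frozen version with `Θ = ∅` implies the unfrozen one. -/
lemma FrozenUniqueContinuation.uniqueContinuation {ε α β Vb lam0 l : ℝ} {V : ℤ × ℤ → ℝ}
    {a : ℤ × ℤ} (h : FrozenUniqueContinuation ε α Vb lam0 a l ∅ V) (hl : 1 ≤ l)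
    (hL : 2 ≤ sideLength l) (hε : 0 < ε) (hε' : ε ≤ 1) (hV : 2 ≤ Vb) (hαβ : α < β) :
    UniqueContinuation ε β Vb lam0 a l V := by
  classical
  intro lam u hlam hsol
  obtain ⟨n, hn⟩ : ∃ n : ℕ, ⌊(l - 1) / 2⌋ = n :=
    Int.eq_ofNat_of_zero_le (Int.floor_nonneg.2 (by linarith))
  set L := sideLength l with hLdef
  have hLn : L = 2 * n := sideLength_eq hn
  have hb1 : 1 < Vb * L := by nlinarith
  have hb0 : 0 < Vb * L := by linarith
  set Q := cube a n with hQ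
  have hbox : box a l = (Q : Set (ℤ × ℤ)) := box_eq_cube a hn
  have hQcard : L ^ 2 ≤ (Q.card : ℝ) := by
    rw [hQ, card_cube, hLn]
    push_cast
    gcongr
    linarith
  have hε3 : ε ^ 3 ≤ 1 := pow_le_one₀ hε.le hε'
  have hfin : (box a (l / 100)).Finite :=
    (cube a (n / 100)).finite_toSet.subset (box_subset_cube a hn)
  have hsup : ∀ b ∈ box a (l / 100), |u b| ≤ supNorm (box a (l / 100)) u := by
    intro b hb
    have : Finite (box a (l / 100)) := hfin
    exact le_ciSup (f := fun b : box a (l / 100) => |u b|) (Set.finite_range _).bddAbove ⟨b, hb⟩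
  set s := supNorm (box a (l / 100)) u with hs
  have hs0 : 0 ≤ s := Real.iSup_nonneg fun _ => abs_nonneg _
  set M := (Vb * L) ^ (-(β * L)) * s with hM
  by_contra! hlt
  rw [hbox] at hlt
  have e1 : {b ∈ (Q : Set (ℤ × ℤ)) | M ≤ |u b|}.ncard = {q ∈ Q | M ≤ |u q|}.card := by
    rw [← Set.ncard_coe_finset]
    congr 1
    ext q; simp
  rw [e1] at hlt
  -- If `u` vanishes on the central box then `M = 0` and every point of `Q` counts; otherwise `M >
  -- 0` and one may divide by it.
  rcases hs0.eq_or_lt with hs0 | hs0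
  · have hM0 : M = 0 := by rw [hM, ← hs0, mul_zero]
    have : {q ∈ Q | M ≤ |u q|} = Q :=
      Finset.filter_true_of_mem fun q _ => by rw [hM0]; exact abs_nonneg _
    rw [this] at hlt
    nlinarith [sq_nonneg L]
  have hM0 : 0 < M := mul_pos (Real.rpow_pos_of_pos hb0 _) hs0
  have hlam' : |lam - lam0| ≤ (L * Vb) ^ (-(α * L)) := by
    rw [mul_comm L]
    exact hlam.trans (Real.rpow_le_rpow_of_exponent_le hb1.le (by nlinarith))
  -- If the claim fails, `|u / M| ≤ 1` off fewer than `ε^3 |Q|` points. The frozen statement then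
  -- gives `s ≤ (Vb L)^(α L) M`, which is less than `s` because `α < β`.
  have hu := h lam (fun b => u b / M) hlam'
    (fun b hb => by
      have := hsol b hb
      simp only [hamiltonian, laplacian] at this ⊢
      field_simp
      linear_combination this)
    (by
      rw [hbox, Set.sdiff_empty, Set.ncard_coe_finset]
      have e2 : {b ∈ (Q : Set (ℤ × ℤ)) | |u b / M| ≤ 1}.ncard = {q ∈ Q | |u q| ≤ M}.card := by
        rw [← Set.ncard_coe_finset]
        congr 1
        ext q
        simp [abs_div, abs_of_pos hM0, div_le_one hM0]
      rw [e2]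
      have e3 := Finset.card_filter_add_card_filter_not (s := Q) (fun q => M ≤ |u q|)
      have e4 : {q ∈ Q | ¬ M ≤ |u q|}.card ≤ {q ∈ Q | |u q| ≤ M}.card :=
        Finset.card_le_card fun q hq => by
          simp only [Finset.mem_filter, not_le] at hq ⊢
          exact ⟨hq.1, hq.2.le⟩
      have e5 : (Q.card : ℝ) ≤ ({q ∈ Q | M ≤ |u q|}.card : ℕ) + ({q ∈ Q | |u q| ≤ M}.card : ℕ) := by
        exact_mod_cast (by omega)
      have e6 : ε ^ 3 * L ^ 2 ≤ ε ^ 3 * Q.card := mul_le_mul_of_nonneg_left hQcard (by positivity)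
      linarith)
  have hle : s ≤ (L * Vb) ^ (α * L) * M := by
    refine Real.iSup_le (fun b => ?_) (by positivity)
    have := hu b b.2
    rwa [abs_div, abs_of_pos hM0, div_le_iff₀ hM0] at this
  have hlt' : (L * Vb) ^ (α * L) * M < s := by
    rw [hM, mul_comm L, ← mul_assoc, ← Real.rpow_add hb0]
    have : (Vb * L) ^ (α * L + -(β * L)) < 1 :=
      Real.rpow_lt_one_of_one_lt_of_neg hb1 (by nlinarith)
    nlinarith
  linarith

end

end AndersonBernoulli

open AndersonBernoulli
theorem theorem1p3 :
    (∃ ε₀ : ℝ, 0 < ε₀ ∧ ∀ ε : ℝ, 0 < ε → ε ≤ ε₀ → ∃ α : ℝ, 1 < α ∧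
      ∀ (lam0 : ℝ) (_ : lam0 ∈ Set.Icc (0 : ℝ) 8) (Vbar : ℝ) (_ : 2 ≤ Vbar)
        (a : ℤ × ℤ) (l : ℝ) (_ : 1 ≤ l) (_ : α ≤ sideLength l)
        (Ω : Type*) [MeasurableSpace Ω] (P : Measure Ω) [IsProbabilityMeasure P]
        (V : ℤ × ℤ → Ω → ℝ) (_ : IsBernoulliPotential P Vbar V),
        1 - Real.exp (-(ε * sideLength l ^ (2 / 3 : ℝ))) ≤
          P.real {ω | UniqueContinuation ε α Vbar lam0 a l (fun b => V b ω)}) ∧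
    (∃ ε₁ : ℝ, 0 < ε₁ ∧ ε₁ < 1 / 100 ∧ ∀ ε : ℝ, 0 < ε → ε ≤ ε₁ → ∃ α : ℝ, 1 < α ∧
      ∀ (a : ℤ × ℤ) (l : ℝ) (_ : 1 ≤ l) (_ : α ≤ sideLength l)
        (Θ : Set (ℤ × ℤ)) (_ : Θ ⊆ box a l) (_ : IsRegularIn ε Θ (box a l))
        (Vbar : ℝ) (_ : 2 ≤ Vbar) (lam0 : ℝ) (_ : lam0 ∈ Set.Icc (0 : ℝ) 8)
        (V' : ℤ × ℤ → ℝ) (_ : ∀ b ∈ Θ, V' b = 0 ∨ V' b = Vbar)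
        (Ω : Type*) [MeasurableSpace Ω] (P : Measure Ω) [IsProbabilityMeasure P]
        (V : ℤ × ℤ → Ω → ℝ) (_ : IsBernoulliPotential P Vbar V),
        1 - Real.exp (-(ε * sideLength l ^ (2 / 3 : ℝ))) ≤
          (ProbabilityTheory.cond P {ω | ∀ b ∈ Θ, V b ω = V' b}).real
            {ω | FrozenUniqueContinuation ε α Vbar lam0 a l Θ (fun b => V b ω)}) := by
  -- The result is invoked twice because the probability spaces of the two parts live in independent
  -- universes.
  obtain ⟨α₀, hα₀, hmain⟩ := exists_frozen_unique_continuation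
  obtain ⟨α₁, hα₁, hmain₁⟩ := exists_frozen_unique_continuation
  refine ⟨⟨1 / 10 ^ 20, by norm_num, fun ε hε hε' => ⟨α₀ + 1, by linarith, ?_⟩⟩,
    ⟨1 / 10 ^ 20, by norm_num, by norm_num, fun ε hε hε' => ⟨α₁, by linarith,
      hmain₁ ε hε hε' α₁ le_rfl⟩⟩⟩
  intro lam0 hlam Vb hV a l hl hαl Ω _ P _ V hBV
  have h := hmain ε hε hε' α₀ le_rfl a l hl (by linarith) ∅ (Set.empty_subset _)
    (isRegularIn_empty hε.le _) Vb hV lam0 hlam (fun _ => 0) (fun _ hb => absurd hb (by simp)) Ω P V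
    hBV
  have hs : {ω | ∀ b ∈ (∅ : Set (ℤ × ℤ)), V b ω = (fun _ => (0 : ℝ)) b} = Set.univ := by
    ext ω; simp
  rw [hs, cond_univ] at h
  refine h.trans (measureReal_mono fun ω hω => ?_)
  exact FrozenUniqueContinuation.uniqueContinuation hω hl (by linarith) hε
    (hε'.trans (by norm_num)) hV (by linarith)
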